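/- Let $d\ge 1$ and let $\mathbb{T}^d=\mathbb{R}^d/\mathbb{Z}^d$ carry the flat metric, with projection $\pi:\mathbb{R}^d\to\mathbb{T}^d$ and Lebesgue measure $\lambda$. For $s\in\mathbb{R}$ let $\mathscr{G}^s$ be the class of $G_\delta$-sets $E\subset\mathbb{R}^d$ with $\mathscr{M}^t_\infty(E\cap D)\ge |D|^t$ for all dyadic cubes $D$ and all $0<t<s$, where $|D|$ is the diameter of $D$, dyadic cubes are the sets $\prod_{i=1}^d[k_i2^{-n},(k_i+1)2^{-n})$ with $n,k_1,\dots,k_d\in\mathbb{Z}$, and $\mathscr{M}^t_\infty(F)=\inf\{\sum_k|D_k|^t : F\subset\bigcup_k D_k,\ D_k \text{ dyadic cubes}\}$ over countable covers; let $\mathscr{G}^s(\mathbb{T}^d)$ be the class of $E\subset\mathbb{T}^d$ with $\pi^{-1}(E)\in\mathscr{G}^s$. For an open ellipsoid $U$ with semi-axes $\lambda_1\ge\dots\ge\lambda_d>0$, or an open rectangle $U$ (a box with pairwise orthogonal sides, in arbitrary position) with half side lengths $\lambda_1\ge\dots\ge\lambda_d>0$, put $\phi^0(U)=1$ and $\phi^t(U)=\lambda_1\cdots\lambda_m\lambda_{m+1}^{t-m}$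 for $0<t\le d$, where $m$ is the integer with $m<t\le m+1$. Let $(B(x_j,r_j))_j$ be a sequence of open balls in $\mathbb{T}^d$ with $r_j\to0$ such that $\limsup_{j\to\infty}B(x_j,r_j)$ has full Lebesgue measure. Let $\tilde U_j\subset\mathbb{R}^d$ be open ellipsoids such that $U_j:=\pi(\tilde U_j)\subset B(x_j,r_j)$ for all $j$, and let $$ s=\sup\Bigl\{\, t\in[0,d] : \sup_j \frac{\lambda(B(x_j,r_j))}{\phi^t(\tilde U_j)}<\infty \,\Bigr\}. $$ Then $\dim_{\mathrm H}\limsup_{j\to\infty}U_j\ge s$ and $\limsup_{j\to\infty}U_j\in\mathscr{G}^s(\mathbb{T}^d)$. The same holds if all the $\tilde U_j$ are open rectangles instead of ellipsoids. -/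

import Mathlib

open Filter Topology MeasureTheory Set

noncomputable section

/-- The lattice `ℤ^d` in the Euclidean space `ℝ^d`. -/
def integerLattice (d : ℕ) : AddSubgroup (EuclideanSpace ℝ (Fin d)) where
  carrier := {x | ∀ i, ∃ n : ℤ, x i = n}
  zero_mem' := fun _ => ⟨0, by simp⟩
  add_mem' := fun {x y} hx hy i => by
    obtain ⟨m, hm⟩ := hx i
    obtain ⟨n, hn⟩ := hy i
    exact ⟨m + n, by simp [hm, hn]⟩
  neg_mem' := fun {x} hx i => by
    obtain ⟨m, hm⟩ := hx i
    exact ⟨-m, by simp [hm]⟩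

/-- Needed for the quotient seminorm on `ℝ^d / ℤ^d` to be a norm. -/
instance integerLattice_isClosed (d : ℕ) :
    IsClosed (integerLattice d : Set (EuclideanSpace ℝ (Fin d))) := by
  have h : (integerLattice d : Set (EuclideanSpace ℝ (Fin d)))
      = ⋂ i : Fin d, (fun x : EuclideanSpace ℝ (Fin d) => x i) ⁻¹'
          Set.range (fun n : ℤ => (n : ℝ)) := by
    ext x
    simp [integerLattice, eq_comm]
  rw [h]
  exact isClosed_iInter fun i =>
    Int.isClosedEmbedding_coe_real.isClosed_range.preimage (by fun_prop)

/-- The torus `𝕋^d = ℝ^d / ℤ^d`. It carries the quotient topology and the flat metric, the distance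
of two points being the smallest Euclidean distance between representatives. -/
abbrev Torus (d : ℕ) : Type := EuclideanSpace ℝ (Fin d) ⧸ integerLattice d

/-- The projection `π : ℝ^d → 𝕋^d`. -/
def torusProj (d : ℕ) (x : EuclideanSpace ℝ (Fin d)) : Torus d :=
  QuotientAddGroup.mk x

/-- Lebesgue measure on the torus: the image under `π` of Lebesgue measure on `[0,1)^d`. -/
def torusMeasure (d : ℕ) : Measure (Torus d) :=
  ((volume : Measure (EuclideanSpace ℝ (Fin d))).restrict
    {x | ∀ i, x i ∈ Set.Ico (0 : ℝ) 1}).map (torusProj d)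

/-- The dyadic cube `∏ i, [k i * 2^(-n), (k i + 1) * 2^(-n))` in `ℝ^d`, where `n` and the `k i` are
integers. -/
def dyadicCube {d : ℕ} (n : ℤ) (k : Fin d → ℤ) : Set (EuclideanSpace ℝ (Fin d)) :=
  {x | ∀ i, x i ∈ Set.Ico ((k i : ℝ) * 2 ^ (-n)) (((k i : ℝ) + 1) * 2 ^ (-n))}

/-- The outer content `𝓜_∞^t(E)`: the infimum of `∑ |D|^t` over the families of dyadic cubes that
cover `E`, where `|D|` is the diameter. A family is given by the set of its indices `(n, k)`,
and is countable because there are only countably many dyadic cubes. -/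
def dyadicContent {d : ℕ} (t : ℝ) (E : Set (EuclideanSpace ℝ (Fin d))) : ENNReal :=
  ⨅ (S : Set (ℤ × (Fin d → ℤ))) (_ : E ⊆ ⋃ p ∈ S, dyadicCube p.1 p.2),
    ∑' p : S, Metric.ediam (dyadicCube (p : ℤ × (Fin d → ℤ)).1 (p : ℤ × (Fin d → ℤ)).2) ^ t

/-- The class `𝓖^s` of sets with large intersections in `ℝ^d`. -/
def largeIntersectionClass (d : ℕ) (s : ℝ) : Set (Set (EuclideanSpace ℝ (Fin d))) :=
  {E | IsGδ E ∧ ∀ (n : ℤ) (k : Fin d → ℤ) (t : ℝ), 0 < t → t < s →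
    Metric.ediam (dyadicCube n k) ^ t ≤ dyadicContent t (E ∩ dyadicCube n k)}

/-- The class `𝓖^s(𝕋^d)` of sets with large intersections in the torus: the sets `E` such that
`π⁻¹(E)` belongs to `𝓖^s`. -/
def torusLargeIntersectionClass (d : ℕ) (s : ℝ) : Set (Set (Torus d)) :=
  {E | torusProj d ⁻¹' E ∈ largeIntersectionClass d s}

/-- The data that determine a nondegenerate ellipsoid, or a nondegenerate rectangle (in arbitrary
position), in `ℝ^d`: its centre, the orthonormal directions of its axes, and the lengths of the
semi-axes in decreasing order. -/
structure PrincipalAxes (d : ℕ) where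
  center : EuclideanSpace ℝ (Fin d)
  dir : OrthonormalBasis (Fin d) ℝ (EuclideanSpace ℝ (Fin d))
  semiAxis : Fin d → ℝ
  semiAxis_pos : ∀ i, 0 < semiAxis i
  semiAxis_antitone : Antitone semiAxis

namespace PrincipalAxes

variable {d : ℕ}

/-- The open ellipsoid in `ℝ^d` with the given centre and semi-axes. -/
def ellipsoid (A : PrincipalAxes d) : Set (EuclideanSpace ℝ (Fin d)) :=
  {y | ∑ i, (inner ℝ (A.dir i) (y - A.center) / A.semiAxis i) ^ 2 < 1}

/-- The open rectangle in `ℝ^d` with the given centre, whose sides have the given directions and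
have half-lengths `A.semiAxis i`. -/
def rectangle (A : PrincipalAxes d) : Set (EuclideanSpace ℝ (Fin d)) :=
  {y | ∀ i, |inner ℝ (A.dir i) (y - A.center)| < A.semiAxis i}

/-- The singular value function: with `a₁ ≥ ⋯ ≥ a_d` the semi-axes,
`φ^t = a₁ ⋯ a_m * a_{m+1}^(t - m)` for `0 < t ≤ d`, where `m` is the integer with `m < t ≤ m + 1`;
and `φ^0 = 1`. (It is only used for `0 ≤ t ≤ d`; the index of `A.semiAxis` starts at `0`.) -/
def singularValue (A : PrincipalAxes d) (t : ℝ) : ℝ :=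
  let m : ℕ := ⌈t⌉₊ - 1
  (∏ i : Fin d, if (i : ℕ) < m then A.semiAxis i else 1) *
    (if h : m < d then A.semiAxis ⟨m, h⟩ ^ (t - (m : ℝ)) else 1)

end PrincipalAxes

end

/-! ### Dyadic cubes -/

section DyadicCubes

variable {d : ℕ}

/-! Fix `t < t'` with `t'` in the set that defines `s`. Spreading the mass of the ball `B_j` evenly
over `U_j` gives a measure that assigns at most a constant times `ρ ^ t'` to sets of diameter `ρ`:
along each axis such a set captures at most a proportion of order `min 1 (ρ / λ_i)` of `U_j`, the
product of these is at most `ρ ^ t' / φ^{t'}(U_j)`, and `λ(B_j)` is at most a constant times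
`φ^{t'}(U_j)` (`singularValue_mul_volume_inter_le`).

In a dyadic cube `D`, Vitali's lemma selects finitely many disjoint balls, as small as desired, that
fill a fixed proportion of `D`. With their masses spread over the sets inside them, the total
measure `μ` satisfies `μ(Q) ≤ C₁ |D|^(d-t) |Q|^t` for all dyadic `Q`: at scales above the radii it
looks like Lebesgue measure, and below them the spare exponent `t' - t` absorbs all constants. By
the mass distribution principle the sets have content at least `c |D|^t` in `D`, with `c`
independent of `D` (`hasDyadicFillings_iUnion`).

Such a uniform bound improves itself. A cover of part of `D` either contains a cube as large as `D`
or splits among the `2^d` children, whose weights add up to `2^(d-t) > 1` times that of `D`; so `c`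
may be replaced by `min 1 (2^(d-t) c)`, and after finitely many steps by `1`
(`HasDyadicFillings.one`). With constant `1`, filling the cubes of a finite family loses no content,
so a Cantor construction can be run through countably many open sets. Passing to the limit by
compactness costs a constant factor, which the same self-improvement removes
(`ediam_rpow_le_dyadicContent_iInter`).

On the torus, small balls have disjoint lifts and each `U_j` lies in a single one. Hence the
preimage of the limsup set contains a countable intersection of unions of translates to which this
applies. The dimension bound follows because positive `t`-content forces positive `t`-dimensional
Hausdorff measure. -/

theorem dyadicCube_subset_of_le {m n : ℤ} (h : m ≤ n) {k l : Fin d → ℤ}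
    (hne : (dyadicCube m k ∩ dyadicCube n l).Nonempty) : dyadicCube n l ⊆ dyadicCube m k := by
  obtain ⟨x, hx, hx'⟩ := hne
  intro y hy i
  obtain ⟨N, hN⟩ := Int.le.dest h
  obtain ⟨h1, h2⟩ := hx i
  obtain ⟨h3, h4⟩ := hx' i
  obtain ⟨h5, h6⟩ := hy i
  have hp : (0 : ℝ) < 2 ^ (-n) := by positivity
  have e : (2 : ℝ) ^ (-m) = ((2 ^ N : ℤ) : ℝ) * 2 ^ (-n) := by
    push_cast
    rw [← zpow_natCast, ← zpow_add₀ (by norm_num)]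
    congr 1
    omega
  rw [e] at h1 h2 ⊢
  rw [← mul_assoc] at h1 h2 ⊢
  have a1 : (k i : ℝ) * (2 ^ N : ℤ) < (l i : ℝ) + 1 := lt_of_mul_lt_mul_right (h1.trans_lt h4) hp.le
  have a2 : (l i : ℝ) < ((k i : ℝ) + 1) * (2 ^ N : ℤ) := lt_of_mul_lt_mul_right (h3.trans_lt h2) hp.le
  have b1 : k i * 2 ^ N ≤ l i := by
    have : k i * 2 ^ N < l i + 1 := by exact_mod_cast a1
    omega
  have b2 : l i + 1 ≤ (k i + 1) * 2 ^ N := by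
    have : l i < (k i + 1) * 2 ^ N := by exact_mod_cast a2
    omega
  have c1 : (k i : ℝ) * (2 ^ N : ℤ) ≤ l i := by exact_mod_cast b1
  have c2 : (l i : ℝ) + 1 ≤ ((k i : ℝ) + 1) * (2 ^ N : ℤ) := by exact_mod_cast b2
  rw [← mul_assoc]
  exact ⟨(mul_le_mul_of_nonneg_right c1 hp.le).trans h5,
    h6.trans_le (mul_le_mul_of_nonneg_right c2 hp.le)⟩

theorem dyadicCube_nested {p q : ℤ × (Fin d → ℤ)}
    (hne : (dyadicCube p.1 p.2 ∩ dyadicCube q.1 q.2).Nonempty) :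
    dyadicCube p.1 p.2 ⊆ dyadicCube q.1 q.2 ∨ dyadicCube q.1 q.2 ⊆ dyadicCube p.1 p.2 := by
  rcases le_total p.1 q.1 with h | h
  · exact Or.inr (dyadicCube_subset_of_le h hne)
  · exact Or.inl (dyadicCube_subset_of_le h (by rwa [inter_comm]))

theorem mem_dyadicCube_iff {n : ℤ} {k : Fin d → ℤ} {x : EuclideanSpace ℝ (Fin d)} :
    x ∈ dyadicCube n k ↔ ∀ i, ⌊x i * 2 ^ n⌋ = k i := by
  refine forall_congr' fun i => ?_
  have hp : (0 : ℝ) < 2 ^ n := by positivity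
  rw [Int.floor_eq_iff, mem_Ico, zpow_neg, ← div_eq_mul_inv, ← div_eq_mul_inv, div_le_iff₀ hp,
    lt_div_iff₀ hp]

theorem mem_dyadicCube_floor (n : ℤ) (x : EuclideanSpace ℝ (Fin d)) :
    x ∈ dyadicCube n (fun i => ⌊x i * 2 ^ n⌋) := mem_dyadicCube_iff.2 fun _ => rfl

theorem dyadicCube_disjoint {n : ℤ} {k l : Fin d → ℤ} (h : k ≠ l) :
    Disjoint (dyadicCube n k) (dyadicCube n l) := by
  refine Set.disjoint_left.2 fun x hx hy => h (funext fun i => ?_)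
  rw [← mem_dyadicCube_iff.1 hx i, mem_dyadicCube_iff.1 hy i]

theorem dyadicCube_nonempty (n : ℤ) (k : Fin d → ℤ) : (dyadicCube n k).Nonempty := by
  refine ⟨WithLp.toLp 2 fun i => (k i : ℝ) * 2 ^ (-n), fun i => ⟨le_rfl, ?_⟩⟩
  have hp : (0 : ℝ) < 2 ^ (-n) := by positivity
  simp only
  nlinarith

theorem measurableSet_dyadicCube (n : ℤ) (k : Fin d → ℤ) : MeasurableSet (dyadicCube n k) := by
  have : dyadicCube n k = ⋂ i, (fun x : EuclideanSpace ℝ (Fin d) => x i) ⁻¹'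
      Set.Ico ((k i : ℝ) * 2 ^ (-n)) (((k i : ℝ) + 1) * 2 ^ (-n)) := by
    ext x; simp [dyadicCube]
  rw [this]
  exact MeasurableSet.iInter fun i => measurableSet_Ico.preimage (by fun_prop)

/-- The closed dyadic cube. -/
noncomputable def closedDyadicCube (n : ℤ) (k : Fin d → ℤ) : Set (EuclideanSpace ℝ (Fin d)) :=
  {x | ∀ i, x i ∈ Set.Icc ((k i : ℝ) * 2 ^ (-n)) (((k i : ℝ) + 1) * 2 ^ (-n))}

theorem dyadicCube_subset_closedDyadicCube (n : ℤ) (k : Fin d → ℤ) :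
    dyadicCube n k ⊆ closedDyadicCube n k := fun _ hx i => Ico_subset_Icc_self (hx i)

theorem isClosed_closedDyadicCube (n : ℤ) (k : Fin d → ℤ) : IsClosed (closedDyadicCube n k) := by
  have : closedDyadicCube n k = ⋂ i, (fun x : EuclideanSpace ℝ (Fin d) => x i) ⁻¹'
      Set.Icc ((k i : ℝ) * 2 ^ (-n)) (((k i : ℝ) + 1) * 2 ^ (-n)) := by
    ext x; simp [closedDyadicCube]
  rw [this]
  exact isClosed_iInter fun i => isClosed_Icc.preimage (by fun_prop)

open scoped Pointwise in
/-- The common diameter of the dyadic cubes of generation `n`, in terms of that of the unit cube. -/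
theorem ediam_dyadicCube (n : ℤ) (k : Fin d → ℤ) :
    Metric.ediam (dyadicCube n k) =
      ENNReal.ofReal (2 ^ (-n)) * Metric.ediam (dyadicCube (d := d) 0 0) := by
  have hp : (0 : ℝ) < 2 ^ (-n) := by positivity
  set c : EuclideanSpace ℝ (Fin d) := WithLp.toLp 2 fun i => (k i : ℝ) * 2 ^ (-n)
  have : dyadicCube n k = (IsometryEquiv.addLeft c) '' ((2 ^ (-n) : ℝ) • dyadicCube 0 0) := by
    ext x
    rw [← IsometryEquiv.coe_toEquiv, Equiv.image_eq_preimage_symm, mem_preimage,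
      mem_smul_set_iff_inv_smul_mem₀ hp.ne']
    refine forall_congr' fun i => ?_
    have : ((2 ^ (-n) : ℝ)⁻¹ • ((IsometryEquiv.addLeft c).toEquiv.symm x)) i
        = (x i - (k i : ℝ) * 2 ^ (-n)) / 2 ^ (-n) := by
      simp [c, IsometryEquiv.addLeft]
      ring
    rw [this, mem_Ico, mem_Ico, le_div_iff₀ hp, div_lt_iff₀ hp]
    simp only [Pi.zero_apply, Int.cast_zero, zero_mul, neg_zero, zpow_zero, zero_add, mul_one,
      one_mul, sub_nonneg, sub_lt_iff_lt_add]
    rw [add_comm (2 ^ (-n) : ℝ), add_mul, one_mul]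
  rw [this, (IsometryEquiv.isometry _).ediam_image, ediam_smul₀, ENNReal.smul_def, smul_eq_mul]
  congr 1
  rw [← ENNReal.ofReal_coe_nnreal]
  simp

theorem abs_sub_le_of_mem_closedDyadicCube {n : ℤ} {k : Fin d → ℤ} {x y : EuclideanSpace ℝ (Fin d)}
    (hx : x ∈ closedDyadicCube n k) (hy : y ∈ closedDyadicCube n k) (i : Fin d) :
    |x i - y i| ≤ 2 ^ (-n) := by
  have h1 := hx i
  have h2 := hy i
  rw [add_mul, one_mul] at h1 h2
  exact abs_sub_le_iff.2 ⟨by linarith [h1.2, h2.1], by linarith [h1.1, h2.2]⟩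

theorem dist_le_of_mem_closedDyadicCube {n : ℤ} {k : Fin d → ℤ} {x y : EuclideanSpace ℝ (Fin d)}
    (hx : x ∈ closedDyadicCube n k) (hy : y ∈ closedDyadicCube n k) :
    dist x y ≤ Real.sqrt (∑ _i : Fin d, (2 ^ (-n) : ℝ) ^ 2) := by
  rw [EuclideanSpace.dist_eq]
  refine Real.sqrt_le_sqrt (Finset.sum_le_sum fun i _ => ?_)
  exact pow_le_pow_left₀ dist_nonneg (abs_sub_le_of_mem_closedDyadicCube hx hy i) 2

theorem isBounded_closedDyadicCube (n : ℤ) (k : Fin d → ℤ) :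
    Bornology.IsBounded (closedDyadicCube n k) := by
  refine Metric.isBounded_iff.2 ⟨Real.sqrt (∑ _i : Fin d, (2 ^ (-n) : ℝ) ^ 2), fun x hx y hy =>
    dist_le_of_mem_closedDyadicCube hx hy⟩

theorem isCompact_closedDyadicCube (n : ℤ) (k : Fin d → ℤ) : IsCompact (closedDyadicCube n k) :=
  Metric.isCompact_of_isClosed_isBounded (isClosed_closedDyadicCube n k)
    (isBounded_closedDyadicCube n k)

/-- The diameter of the unit cube, as a real number. -/
noncomputable def unitDiam (d : ℕ) : ℝ := (Metric.ediam (dyadicCube (d := d) 0 0)).toReal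

theorem ediam_unit_ne_top : Metric.ediam (dyadicCube (d := d) 0 0) ≠ ⊤ :=
  ((isBounded_closedDyadicCube 0 0).subset (dyadicCube_subset_closedDyadicCube 0 0)).ediam_ne_top

theorem unitDiam_pos (hd : 1 ≤ d) : 0 < unitDiam d := by
  refine ENNReal.toReal_pos (fun h => ?_) ediam_unit_ne_top
  rw [Metric.ediam_eq_zero_iff] at h
  have h0 : (0 : EuclideanSpace ℝ (Fin d)) ∈ dyadicCube 0 0 := fun i => by simp
  have h1 : (WithLp.toLp 2 fun _ => 1 / 2 : EuclideanSpace ℝ (Fin d)) ∈ dyadicCube 0 0 :=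
    fun i => by norm_num
  have := congrArg (fun x : EuclideanSpace ℝ (Fin d) => x ⟨0, hd⟩) (h h0 h1)
  norm_num at this

/-- The diameter of the dyadic cubes of generation `n`. -/
noncomputable def genDiam (d : ℕ) (n : ℤ) : ℝ := 2 ^ (-n) * unitDiam d

theorem ediam_dyadicCube_eq_ofReal (n : ℤ) (k : Fin d → ℤ) :
    Metric.ediam (dyadicCube n k) = ENNReal.ofReal (genDiam d n) := by
  rw [ediam_dyadicCube, genDiam, ENNReal.ofReal_mul (by positivity), unitDiam,
    ENNReal.ofReal_toReal ediam_unit_ne_top]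

theorem genDiam_pos (hd : 1 ≤ d) (n : ℤ) : 0 < genDiam d n :=
  mul_pos (by positivity) (unitDiam_pos hd)

theorem genDiam_add_one (n : ℤ) : genDiam d (n + 1) = genDiam d n / 2 := by
  rw [genDiam, genDiam, neg_add, zpow_add₀ (by norm_num), zpow_neg_one]
  ring

theorem dist_le_genDiam {n : ℤ} {k : Fin d → ℤ} {x y : EuclideanSpace ℝ (Fin d)}
    (hx : x ∈ dyadicCube n k) (hy : y ∈ dyadicCube n k) : dist x y ≤ genDiam d n := by
  have := Metric.edist_le_ediam_of_mem hx hy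
  rw [ediam_dyadicCube_eq_ofReal, edist_dist] at this
  exact (ENNReal.ofReal_le_ofReal_iff (mul_nonneg (by positivity) ENNReal.toReal_nonneg)).1 this

theorem volume_dyadicCube (n : ℤ) (k : Fin d → ℤ) :
    volume (dyadicCube n k) = ENNReal.ofReal ((2 ^ (-n)) ^ d) := by
  have h : dyadicCube n k = (MeasurableEquiv.toLp 2 (Fin d → ℝ)).symm ⁻¹'
      (Set.univ.pi fun i => Set.Ico ((k i : ℝ) * 2 ^ (-n)) (((k i : ℝ) + 1) * 2 ^ (-n))) := by
    ext x; simp [dyadicCube]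
  rw [h, (EuclideanSpace.volume_preserving_symm_measurableEquiv_toLp (Fin d)).measure_preimage
    (MeasurableSet.univ_pi fun i => measurableSet_Ico).nullMeasurableSet, Real.volume_pi_Ico]
  simp only [add_mul, one_mul, add_sub_cancel_left]
  rw [Finset.prod_const, Finset.card_univ, Fintype.card_fin, ENNReal.ofReal_pow (by positivity)]

end DyadicCubes

/-! ### The dyadic content -/

section DyadicContent

variable {d : ℕ}

/-- The union of the dyadic cubes with indices in `S`. -/
def dyadicUnion (S : Set (ℤ × (Fin d → ℤ))) : Set (EuclideanSpace ℝ (Fin d)) :=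
  ⋃ p ∈ S, dyadicCube p.1 p.2

/-- The `t`-th power of the diameter of a dyadic cube. -/
noncomputable def cubeWeight (t : ℝ) (p : ℤ × (Fin d → ℤ)) : ENNReal :=
  Metric.ediam (dyadicCube p.1 p.2) ^ t

/-- The sum of the `t`-th powers of the diameters of the dyadic cubes with indices in `S`. -/
noncomputable def coverSum (t : ℝ) (S : Set (ℤ × (Fin d → ℤ))) : ENNReal :=
  ∑' p : S, cubeWeight t (p : ℤ × (Fin d → ℤ))

theorem mem_dyadicUnion {S : Set (ℤ × (Fin d → ℤ))} {x : EuclideanSpace ℝ (Fin d)} :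
    x ∈ dyadicUnion S ↔ ∃ p ∈ S, x ∈ dyadicCube p.1 p.2 := by
  simp [dyadicUnion]

theorem dyadicContent_le {t : ℝ} {E : Set (EuclideanSpace ℝ (Fin d))}
    {S : Set (ℤ × (Fin d → ℤ))} (h : E ⊆ dyadicUnion S) : dyadicContent t E ≤ coverSum t S :=
  iInf₂_le S h

theorem le_dyadicContent {t : ℝ} {E : Set (EuclideanSpace ℝ (Fin d))} {a : ENNReal}
    (h : ∀ S, E ⊆ dyadicUnion S → a ≤ coverSum t S) : a ≤ dyadicContent t E :=
  le_iInf₂ h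

theorem dyadicContent_mono {t : ℝ} {E F : Set (EuclideanSpace ℝ (Fin d))} (h : E ⊆ F) :
    dyadicContent t E ≤ dyadicContent t F :=
  le_dyadicContent fun _ hS => dyadicContent_le (h.trans hS)

theorem coverSum_mono {t : ℝ} {S T : Set (ℤ × (Fin d → ℤ))} (h : S ⊆ T) :
    coverSum t S ≤ coverSum t T :=
  ENNReal.tsum_mono_subtype (cubeWeight t) h

theorem le_coverSum {t : ℝ} {S : Set (ℤ × (Fin d → ℤ))} {p : ℤ × (Fin d → ℤ)} (h : p ∈ S) :
    Metric.ediam (dyadicCube p.1 p.2) ^ t ≤ coverSum t S :=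
  ENNReal.le_tsum (f := fun p : S => cubeWeight t (p : ℤ × (Fin d → ℤ))) ⟨p, h⟩

theorem coverSum_union_le (t : ℝ) (S T : Set (ℤ × (Fin d → ℤ))) :
    coverSum t (S ∪ T) ≤ coverSum t S + coverSum t T :=
  ENNReal.tsum_union_le (cubeWeight t) S T

theorem coverSum_union (t : ℝ) {S T : Set (ℤ × (Fin d → ℤ))} (h : Disjoint S T) :
    coverSum t (S ∪ T) = coverSum t S + coverSum t T :=
  ENNReal.summable.tsum_union_disjoint (f := cubeWeight t) h
    ENNReal.summable

theorem coverSum_biUnion {ι : Type*} (t : ℝ) {I : Finset ι} {T : ι → Set (ℤ × (Fin d → ℤ))}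
    (h : (I : Set ι).PairwiseDisjoint T) :
    coverSum t (⋃ i ∈ I, T i) = ∑ i ∈ I, coverSum t (T i) :=
  Summable.tsum_finset_bUnion_disjoint (f := cubeWeight t) h
    fun _ _ => ENNReal.summable

theorem coverSum_finset (t : ℝ) (S : Finset (ℤ × (Fin d → ℤ))) :
    coverSum t (S : Set (ℤ × (Fin d → ℤ))) =
      ∑ p ∈ S, Metric.ediam (dyadicCube p.1 p.2) ^ t :=
  Finset.tsum_subtype' S (cubeWeight t)

/-- The mass distribution principle. -/
theorem measure_div_le_dyadicContent {t : ℝ} (μ : Measure (EuclideanSpace ℝ (Fin d)))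
    {C : ENNReal} (h : ∀ n k, μ (dyadicCube n k) ≤ C * Metric.ediam (dyadicCube n k) ^ t)
    (F : Set (EuclideanSpace ℝ (Fin d))) : μ F / C ≤ dyadicContent t F := by
  refine le_dyadicContent fun S hS => ENNReal.div_le_of_le_mul' ?_
  calc μ F ≤ μ (dyadicUnion S) := measure_mono hS
    _ ≤ ∑' p : S, μ (dyadicCube (p : ℤ × (Fin d → ℤ)).1 (p : ℤ × (Fin d → ℤ)).2) :=
      measure_biUnion_le μ (to_countable S) _
    _ ≤ C * coverSum t S := by
      rw [coverSum, ← ENNReal.tsum_mul_left]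
      exact ENNReal.tsum_le_tsum fun p => h _ _

theorem dyadicContent_iUnion_le (t : ℝ) (E : ℕ → Set (EuclideanSpace ℝ (Fin d))) :
    dyadicContent t (⋃ i, E i) ≤ ∑' i, dyadicContent t (E i) := by
  refine ENNReal.le_of_forall_pos_le_add fun ε hε hfin => ?_
  obtain ⟨δ, hδ, hsum⟩ := ENNReal.exists_pos_sum_of_countable'
    (ENNReal.coe_pos.2 hε).ne' ℕ
  have hlt : ∀ i, ∃ S, E i ⊆ dyadicUnion S ∧ coverSum t S ≤ dyadicContent t (E i) + δ i := by
    intro i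
    have h1 : dyadicContent t (E i) < dyadicContent t (E i) + δ i :=
      ENNReal.lt_add_right ((ENNReal.le_tsum i).trans_lt hfin).ne (hδ i).ne'
    by_contra! hcon
    exact absurd (le_dyadicContent fun S hS => (hcon S hS).le) (not_le.2 h1)
  choose S hS hS' using hlt
  calc dyadicContent t (⋃ i, E i) ≤ coverSum t (⋃ i, S i) := by
        refine dyadicContent_le (iUnion_subset fun i x hx => ?_)
        obtain ⟨p, hp, hxp⟩ := mem_dyadicUnion.1 (hS i hx)
        exact mem_dyadicUnion.2 ⟨p, mem_iUnion.2 ⟨i, hp⟩, hxp⟩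
    _ ≤ ∑' i, coverSum t (S i) :=
        ENNReal.tsum_iUnion_le_tsum (cubeWeight t) S
    _ ≤ ∑' i, (dyadicContent t (E i) + δ i) := ENNReal.tsum_le_tsum hS'
    _ = ∑' i, dyadicContent t (E i) + ∑' i, δ i := ENNReal.tsum_add
    _ ≤ _ := by gcongr

/-! ### Children of a cube -/

/-- The position of the child number `e` of the dyadic cube at position `k`. -/
def childIndex (k : Fin d → ℤ) (e : Fin d → Fin 2) : Fin d → ℤ := fun i => 2 * k i + (e i : ℕ)

theorem childIndex_injective (k : Fin d → ℤ) : Function.Injective (childIndex k) := by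
  intro e f h
  funext i
  have := congrFun h i
  simp only [childIndex] at this
  omega

theorem child_subset (n : ℤ) (k : Fin d → ℤ) (e : Fin d → Fin 2) :
    dyadicCube (n + 1) (childIndex k e) ⊆ dyadicCube n k := by
  intro x hx i
  obtain ⟨h1, h2⟩ := hx i
  have hp : (0 : ℝ) < 2 ^ (-(n + 1)) := by positivity
  have e1 : (2 : ℝ) ^ (-n) = 2 * 2 ^ (-(n + 1)) := by
    rw [neg_add, zpow_add₀ (by norm_num), zpow_neg_one]
    ring
  have e2 : ((e i : ℕ) : ℝ) ≤ 1 := by exact_mod_cast Nat.lt_succ_iff.1 (e i).2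
  have e3 : (0 : ℝ) ≤ ((e i : ℕ) : ℝ) := Nat.cast_nonneg _
  rw [e1]
  simp only [childIndex, Int.cast_add, Int.cast_mul, Int.cast_ofNat, Int.cast_natCast] at h1 h2
  constructor <;> nlinarith

/-- There are `2^d` children, each with `2^(-t)` times the weight of the parent. For `t < d` the
factor exceeds `1`, which drives every improvement of constants below. -/
theorem sum_child_weight (t : ℝ) (n : ℤ) (k : Fin d → ℤ) :
    ∑ e : Fin d → Fin 2, Metric.ediam (dyadicCube (n + 1) (childIndex k e)) ^ t =
      2 ^ ((d : ℝ) - t) * Metric.ediam (dyadicCube n k) ^ t := by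
  have h : ∀ e : Fin d → Fin 2, Metric.ediam (dyadicCube (n + 1) (childIndex k e)) ^ t =
      2 ^ (-t) * Metric.ediam (dyadicCube n k) ^ t := by
    intro e
    rw [ediam_dyadicCube_eq_ofReal, ediam_dyadicCube_eq_ofReal, genDiam_add_one,
      ENNReal.ofReal_div_of_pos two_pos, ENNReal.ofReal_ofNat, div_eq_mul_inv, mul_comm,
      ENNReal.mul_rpow_of_ne_top (by simp) ENNReal.ofReal_ne_top, ENNReal.rpow_neg,
      ENNReal.inv_rpow]
  rw [Finset.sum_congr rfl fun e _ => h e, Finset.sum_const, Finset.card_univ, nsmul_eq_mul,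
    ← mul_assoc]
  congr 1
  rw [sub_eq_add_neg, ENNReal.rpow_add _ _ (by simp) (by simp)]
  simp

/-- A cover of part of a dyadic cube either contains a cube that is at least as large, or splits
into covers of the parts in the children. -/
theorem min_le_dyadicContent {t : ℝ} (ht : 0 ≤ t) (A : Set (EuclideanSpace ℝ (Fin d))) (n : ℤ)
    (k : Fin d → ℤ) :
    min (Metric.ediam (dyadicCube n k) ^ t)
      (∑ e : Fin d → Fin 2, dyadicContent t (A ∩ dyadicCube (n + 1) (childIndex k e))) ≤
    dyadicContent t (A ∩ dyadicCube n k) := by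
  refine le_dyadicContent fun S hS => ?_
  by_cases hbig : ∃ p ∈ S, dyadicCube n k ⊆ dyadicCube p.1 p.2
  · obtain ⟨p, hp, hsub⟩ := hbig
    exact (min_le_left _ _).trans ((ENNReal.rpow_le_rpow (Metric.ediam_mono hsub) ht).trans
      (le_coverSum hp))
  push Not at hbig
  refine (min_le_right _ _).trans ?_
  let T : (Fin d → Fin 2) → Set (ℤ × (Fin d → ℤ)) := fun e =>
    {p ∈ S | dyadicCube p.1 p.2 ⊆ dyadicCube (n + 1) (childIndex k e)}
  have hT : ∀ e, A ∩ dyadicCube (n + 1) (childIndex k e) ⊆ dyadicUnion (T e) := by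
    intro e x hx
    have hxD := child_subset n k e hx.2
    obtain ⟨p, hp, hxp⟩ := mem_dyadicUnion.1 (hS ⟨hx.1, hxD⟩)
    refine mem_dyadicUnion.2 ⟨p, ⟨hp, ?_⟩, hxp⟩
    -- A cube of the cover that meets the child is either coarse, and then contains the whole
    -- parent, or it has at least the child's generation and lies inside the child.
    rcases le_or_gt p.1 n with h | h
    · exact absurd (dyadicCube_subset_of_le h ⟨x, hxp, hxD⟩) (hbig p hp)
    · exact dyadicCube_subset_of_le h ⟨x, hx.2, hxp⟩
  have hdisj : ((Finset.univ : Finset (Fin d → Fin 2)) : Set (Fin d → Fin 2)).PairwiseDisjoint T := by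
    intro e _ f _ hef
    refine Set.disjoint_left.2 fun p hp hp' => ?_
    obtain ⟨x, hx⟩ := dyadicCube_nonempty p.1 p.2
    exact Set.disjoint_left.1 (dyadicCube_disjoint ((childIndex_injective k).ne hef))
      (hp.2 hx) (hp'.2 hx)
  calc _ ≤ ∑ e : Fin d → Fin 2, coverSum t (T e) :=
        Finset.sum_le_sum fun e _ => dyadicContent_le (hT e)
    _ = coverSum t (⋃ e ∈ Finset.univ, T e) := (coverSum_biUnion t hdisj).symm
    _ ≤ coverSum t S := coverSum_mono (iUnion₂_subset fun e _ => sep_subset _ _)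

theorem min_le_dyadicContent_of_children {t : ℝ} (ht : 0 ≤ t) {c : ENNReal}
    (A : Set (EuclideanSpace ℝ (Fin d))) (n : ℤ) (k : Fin d → ℤ)
    (h : ∀ e : Fin d → Fin 2, c * Metric.ediam (dyadicCube (n + 1) (childIndex k e)) ^ t ≤
      dyadicContent t (A ∩ dyadicCube (n + 1) (childIndex k e))) :
    min 1 (2 ^ ((d : ℝ) - t) * c) * Metric.ediam (dyadicCube n k) ^ t ≤
      dyadicContent t (A ∩ dyadicCube n k) := by
  refine le_trans ?_ (min_le_dyadicContent ht A n k)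
  refine le_min ?_ ?_
  · exact (mul_le_mul_left (min_le_left _ _) _).trans (one_mul _).le
  · calc _ ≤ (2 ^ ((d : ℝ) - t) * c) * Metric.ediam (dyadicCube n k) ^ t := by
          gcongr; exact min_le_right _ _
      _ = c * ∑ e : Fin d → Fin 2,
          Metric.ediam (dyadicCube (n + 1) (childIndex k e)) ^ t := by
          rw [sum_child_weight]; ring
      _ ≤ _ := by
          rw [Finset.mul_sum]
          exact Finset.sum_le_sum fun e _ => h e

/-- Iterating the step from `c` to `min 1 (a * c)` with `a > 1` one arrives at `1`. -/
theorem ENNReal.induction_min_one_mul {P : ENNReal → Prop} {a c : ENNReal} (ha : 1 < a)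
    (hc : c ≠ 0) (h0 : P c) (hmono : ∀ x y, x ≤ y → P y → P x)
    (hstep : ∀ x, P x → P (min 1 (a * x))) : P 1 := by
  have h : ∀ n : ℕ, P (min 1 (a ^ n * c)) := by
    intro n
    induction n with
    | zero => exact hmono _ _ (by simp) h0
    | succ n ih =>
      refine hmono _ _ ?_ (hstep _ ih)
      refine le_min (min_le_left _ _) ?_
      rcases le_total 1 (a ^ n * c) with h1 | h1
      · rw [min_eq_left h1, mul_one]
        exact (min_le_left _ _).trans ha.le
      · rw [min_eq_right h1, ← mul_assoc, ← pow_succ']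
        exact min_le_right _ _
  have ht := ENNReal.tendsto_pow_atTop_nhds_top_iff.2 ha
  obtain ⟨n, hn⟩ := (ht.eventually (lt_mem_nhds (ENNReal.inv_lt_top.2 (pos_iff_ne_zero.2 hc)))).exists
  have h1 : 1 ≤ a ^ n * c := by
    rcases eq_or_ne c ⊤ with rfl | hct
    · rw [ENNReal.mul_top (pow_ne_zero _ (zero_lt_one.trans ha).ne')]
      exact le_top
    · rw [← ENNReal.inv_mul_cancel hc hct]
      gcongr
  simpa [h1] using h n

theorem one_lt_two_rpow_sub {t : ℝ} (h : t < d) : (1 : ENNReal) < 2 ^ ((d : ℝ) - t) :=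
  ENNReal.one_lt_rpow (by norm_num) (by linarith)

/-- A uniform lower bound for the content of the parts of `A` in dyadic cubes improves itself to
the greatest possible one. -/
theorem ediam_rpow_le_dyadicContent {t : ℝ} (ht : 0 ≤ t) (htd : t < d)
    {A : Set (EuclideanSpace ℝ (Fin d))} {c : ENNReal} (hc : c ≠ 0)
    (h : ∀ n k, c * Metric.ediam (dyadicCube n k) ^ t ≤ dyadicContent t (A ∩ dyadicCube n k))
    (n : ℤ) (k : Fin d → ℤ) :
    Metric.ediam (dyadicCube n k) ^ t ≤ dyadicContent t (A ∩ dyadicCube n k) := by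
  have := ENNReal.induction_min_one_mul (P := fun c => ∀ n k, c * Metric.ediam (dyadicCube n k) ^ t
    ≤ dyadicContent t (A ∩ dyadicCube n k)) (one_lt_two_rpow_sub htd) hc h
    (fun x y hxy hy n k => le_trans (by gcongr) (hy n k))
    (fun x hx n k => min_le_dyadicContent_of_children ht A n k fun e => hx _ _) n k
  simpa using this

/-! ### Finite families of cubes -/

/-- Every dyadic cube `D` contains a finite disjoint family of dyadic cubes whose closures are
subsets of `G`, and whose union has content at least `c * |D| ^ t`. -/
def HasDyadicFillings (t : ℝ) (c : ENNReal) (G : Set (EuclideanSpace ℝ (Fin d))) : Prop :=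
  ∀ n k, ∃ S : Finset (ℤ × (Fin d → ℤ)),
    (S : Set (ℤ × (Fin d → ℤ))).PairwiseDisjoint (fun p => dyadicCube p.1 p.2) ∧
    (∀ p ∈ S, dyadicCube p.1 p.2 ⊆ dyadicCube n k ∧ closedDyadicCube p.1 p.2 ⊆ G) ∧
    c * Metric.ediam (dyadicCube n k) ^ t ≤ dyadicContent t (dyadicUnion (d := d) S)

/-- Fillings of the children together form a filling of the parent, with the constant multiplied by
`2^(d-t)` and capped at `1`. Constant exactly `1` is what allows fillings to be iterated without
loss. -/
theorem HasDyadicFillings.one {t : ℝ} (ht : 0 ≤ t) (htd : t < d) {c : ENNReal} (hc : c ≠ 0)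
    {G : Set (EuclideanSpace ℝ (Fin d))} (h : HasDyadicFillings t c G) :
    HasDyadicFillings t 1 G := by
  classical
  refine ENNReal.induction_min_one_mul (P := fun c => HasDyadicFillings t c G)
    (one_lt_two_rpow_sub htd) hc h ?_ ?_
  · intro x y hxy hy n k
    obtain ⟨S, h1, h2, h3⟩ := hy n k
    exact ⟨S, h1, h2, le_trans (by gcongr) h3⟩
  · intro x hx n k
    choose S h1 h2 h3 using fun e : Fin d → Fin 2 => hx (n + 1) (childIndex k e)
    refine ⟨Finset.univ.biUnion S, ?_, ?_, ?_⟩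
    · intro p hp q hq hpq
      simp only [Finset.coe_biUnion, Finset.coe_univ, mem_univ, iUnion_true, mem_iUnion,
        Finset.mem_coe] at hp hq
      obtain ⟨e, he⟩ := hp
      obtain ⟨f, hf⟩ := hq
      by_cases hef : e = f
      · subst hef
        exact h1 e he hf hpq
      · exact (dyadicCube_disjoint ((childIndex_injective k).ne hef)).mono
          (h2 e p he).1 (h2 f q hf).1
    · intro p hp
      obtain ⟨e, -, he⟩ := Finset.mem_biUnion.1 hp
      exact ⟨(h2 e p he).1.trans (child_subset n k e), (h2 e p he).2⟩
    · refine (min_le_dyadicContent_of_children ht (dyadicUnion (Finset.univ.biUnion S : Finset _))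
        n k fun e => (h3 e).trans (dyadicContent_mono ?_)).trans
          (dyadicContent_mono inter_subset_left)
      intro y hy
      obtain ⟨p, hp, hyp⟩ := mem_dyadicUnion.1 hy
      exact ⟨mem_dyadicUnion.2 ⟨p, Finset.mem_coe.2 (Finset.mem_biUnion.2
        ⟨e, Finset.mem_univ e, hp⟩), hyp⟩, (h2 e p hp).1 hyp⟩

/-- Filling the members of a disjoint family of cubes does not decrease the content. -/
theorem dyadicContent_le_of_fill {t : ℝ} {S : Finset (ℤ × (Fin d → ℤ))}
    (hS : (S : Set (ℤ × (Fin d → ℤ))).PairwiseDisjoint (fun p => dyadicCube p.1 p.2))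
    {F : ℤ × (Fin d → ℤ) → Set (EuclideanSpace ℝ (Fin d))}
    (hsub : ∀ p ∈ S, F p ⊆ dyadicCube p.1 p.2)
    (hF : ∀ p ∈ S, Metric.ediam (dyadicCube p.1 p.2) ^ t ≤ dyadicContent t (F p)) :
    dyadicContent t (dyadicUnion (d := d) S) ≤ dyadicContent t (⋃ p ∈ S, F p) := by
  classical
  refine le_dyadicContent fun T hT => ?_
  -- These are the cubes of `S` that no single cube of `T` swallows. Each is filled by a set that
  -- `T` covers with smaller cubes, so exchanging those for the cube itself does not increase the
  -- sum and yields a cover of the unfilled union.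
  let S' := S.filter fun p => ∀ q ∈ T, ¬ dyadicCube p.1 p.2 ⊆ dyadicCube q.1 q.2
  have hS'S : ∀ p ∈ S', p ∈ S := fun p hp => (Finset.mem_filter.1 hp).1
  let R : ℤ × (Fin d → ℤ) → Set (ℤ × (Fin d → ℤ)) := fun p =>
    {q ∈ T | dyadicCube q.1 q.2 ⊆ dyadicCube p.1 p.2}
  have hR : ∀ p ∈ S', F p ⊆ dyadicUnion (R p) := by
    intro p hp x hx
    obtain ⟨q, hq, hxq⟩ := mem_dyadicUnion.1 (hT (mem_biUnion (hS'S p hp) hx))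
    refine mem_dyadicUnion.2 ⟨q, ⟨hq, ?_⟩, hxq⟩
    exact (dyadicCube_nested ⟨x, hsub p (hS'S p hp) hx, hxq⟩).resolve_left
      ((Finset.mem_filter.1 hp).2 q hq)
  have hdisj : (S' : Set (ℤ × (Fin d → ℤ))).PairwiseDisjoint R := by
    intro p hp q hq hpq
    refine Set.disjoint_left.2 fun z hz hz' => ?_
    obtain ⟨x, hx⟩ := dyadicCube_nonempty z.1 z.2
    exact Set.disjoint_left.1 (hS (hS'S p hp) (hS'S q hq) hpq) (hz.2 hx) (hz'.2 hx)
  set U := ⋃ p ∈ S', R p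
  have hUT : U ⊆ T := iUnion₂_subset fun p _ => sep_subset _ _
  have hcov : dyadicUnion (d := d) S ⊆ dyadicUnion ((T \ U) ∪ (S' : Set (ℤ × (Fin d → ℤ)))) := by
    intro x hx
    obtain ⟨p, hp, hxp⟩ := mem_dyadicUnion.1 hx
    by_cases hp' : p ∈ S'
    · exact mem_dyadicUnion.2 ⟨p, Or.inr hp', hxp⟩
    have : ∃ q ∈ T, dyadicCube p.1 p.2 ⊆ dyadicCube q.1 q.2 := by
      by_contra! hcon
      exact hp' (Finset.mem_filter.2 ⟨hp, hcon⟩)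
    obtain ⟨q, hq, hpq⟩ := this
    by_cases hqU : q ∈ U
    · obtain ⟨z, hz, hqz⟩ := mem_iUnion₂.1 hqU
      exact mem_dyadicUnion.2 ⟨z, Or.inr hz, hqz.2 (hpq hxp)⟩
    · exact mem_dyadicUnion.2 ⟨q, Or.inl ⟨hq, hqU⟩, hpq hxp⟩
  calc _ ≤ coverSum t ((T \ U) ∪ (S' : Set (ℤ × (Fin d → ℤ)))) := dyadicContent_le hcov
    _ ≤ coverSum t (T \ U) + coverSum t (S' : Set (ℤ × (Fin d → ℤ))) := coverSum_union_le _ _ _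
    _ ≤ coverSum t (T \ U) + coverSum t U := by
        gcongr
        rw [coverSum_finset, coverSum_biUnion t hdisj]
        exact Finset.sum_le_sum fun p hp => (hF p (hS'S p hp)).trans (dyadicContent_le (hR p hp))
    _ = coverSum t T := by
        rw [← coverSum_union t disjoint_sdiff_left, sdiff_union_of_subset hUT]

/-! ### Neighbouring cubes -/

/-- The neighbour number `e` of a dyadic cube. -/
def neighbour (e : Fin d → Fin 3) (p : ℤ × (Fin d → ℤ)) : ℤ × (Fin d → ℤ) :=
  (p.1, fun i => p.2 i + (e i : ℕ) - 1)

theorem neighbour_injective (e : Fin d → Fin 3) : Function.Injective (neighbour e) := by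
  rintro ⟨n, k⟩ ⟨m, l⟩ h
  simp only [neighbour, Prod.mk.injEq] at h
  obtain ⟨rfl, h⟩ := h
  congr 1
  funext i
  have := congrFun h i
  omega

theorem exists_mem_neighbour {n : ℤ} {k : Fin d → ℤ} {x : EuclideanSpace ℝ (Fin d)}
    (h : ∀ i, k i - 1 ≤ ⌊x i * 2 ^ n⌋ ∧ ⌊x i * 2 ^ n⌋ ≤ k i + 1) :
    ∃ e, x ∈ dyadicCube (neighbour e (n, k)).1 (neighbour e (n, k)).2 := by
  refine ⟨fun i => ⟨(⌊x i * 2 ^ n⌋ - (k i - 1)).toNat, ?_⟩, mem_dyadicCube_iff.2 fun i => ?_⟩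
  · have := h i
    omega
  · have := h i
    simp only [neighbour]
    omega

theorem coverSum_neighbours_le (t : ℝ) (S : Set (ℤ × (Fin d → ℤ))) :
    coverSum t (⋃ e : Fin d → Fin 3, neighbour e '' S) ≤ 3 ^ d * coverSum t S := by
  refine (ENNReal.tsum_iUnion_le (cubeWeight t) _).trans ?_
  have : ∀ e : Fin d → Fin 3, ∑' p : neighbour e '' S, cubeWeight t (p : ℤ × (Fin d → ℤ)) = coverSum t S := by
    intro e
    rw [tsum_image (cubeWeight t)
      (neighbour_injective e).injOn, coverSum]
    refine tsum_congr fun p => ?_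
    rw [cubeWeight, cubeWeight, ediam_dyadicCube_eq_ofReal, ediam_dyadicCube_eq_ofReal, neighbour]
  rw [Finset.sum_congr rfl fun e _ => this e]
  simp

/-- Half-open cubes are not open, so compactness does not apply to covers by them. Adding the
neighbours makes the cover open at the price of a factor `3^d`. -/
theorem dyadicCube_subset_interior_neighbours (p : ℤ × (Fin d → ℤ)) :
    dyadicCube p.1 p.2 ⊆
      interior (⋃ e, dyadicCube (neighbour e p).1 (neighbour e p).2) := by
  have hp : (0 : ℝ) < 2 ^ p.1 := by positivity
  set O : Set (EuclideanSpace ℝ (Fin d)) :=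
    {x | ∀ i, x i * 2 ^ p.1 ∈ Ioo ((p.2 i : ℝ) - 1) ((p.2 i : ℝ) + 2)}
  have hO : IsOpen O := by
    have : O = ⋂ i, (fun x : EuclideanSpace ℝ (Fin d) => x i * 2 ^ p.1) ⁻¹'
        Ioo ((p.2 i : ℝ) - 1) ((p.2 i : ℝ) + 2) := by
      ext x; simp [O]
    rw [this]
    exact isOpen_iInter_of_finite fun i => isOpen_Ioo.preimage (by fun_prop)
  have hsub : O ⊆ ⋃ e, dyadicCube (neighbour e p).1 (neighbour e p).2 := by
    intro x hx
    refine mem_iUnion.2 (exists_mem_neighbour fun i => ⟨Int.le_floor.2 ?_, ?_⟩)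
    · push_cast
      exact (hx i).1.le
    · refine Int.lt_add_one_iff.1 (Int.floor_lt.2 ?_)
      push_cast
      linarith [(hx i).2]
  intro x hx
  refine interior_maximal hsub hO fun i => ?_
  have := Int.floor_eq_iff.1 (mem_dyadicCube_iff.1 hx i)
  exact ⟨by linarith [this.1], by linarith [this.2]⟩

/-- The content of a set of diameter at most `2 ^ (-n)`. -/
theorem dyadicContent_le_of_dist_le {t : ℝ} {A : Set (EuclideanSpace ℝ (Fin d))} {n : ℤ}
    (h : ∀ x ∈ A, ∀ y ∈ A, dist x y ≤ 2 ^ (-n)) :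
    dyadicContent t A ≤ 3 ^ d * ENNReal.ofReal (genDiam d n) ^ t := by
  rcases A.eq_empty_or_nonempty with rfl | ⟨a, ha⟩
  · refine (dyadicContent_le (S := ∅) (empty_subset _)).trans ?_
    simp [coverSum]
  have hp : (0 : ℝ) < 2 ^ n := by positivity
  set p : ℤ × (Fin d → ℤ) := (n, fun i => ⌊a i * 2 ^ n⌋)
  have hcov : A ⊆ dyadicUnion (⋃ e : Fin d → Fin 3, neighbour e '' {p}) := by
    intro x hx
    have hxa : ∀ i, |x i * 2 ^ n - a i * 2 ^ n| ≤ 1 := by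
      intro i
      have h1 : |x i - a i| ≤ 2 ^ (-n) := by
        have := (EuclideanSpace.norm_eq (x - a)) ▸ Real.abs_le_sqrt
          (Finset.single_le_sum (f := fun i => ‖(x - a) i‖ ^ 2) (fun i _ => sq_nonneg _)
            (Finset.mem_univ i))
        rw [abs_norm] at this
        exact this.trans (dist_eq_norm x a ▸ h x hx a ha)
      rw [← sub_mul, abs_mul, abs_of_pos hp]
      calc _ ≤ (2 : ℝ) ^ (-n) * 2 ^ n := by gcongr
        _ = 1 := by rw [← zpow_add₀ (by norm_num)]; simp
    obtain ⟨e, he⟩ := exists_mem_neighbour (n := n) (k := fun i => ⌊a i * 2 ^ n⌋) (x := x)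
      fun i => by
        have h2 := abs_le.1 (hxa i)
        have h3 := Int.floor_le (a i * 2 ^ n)
        have h4 := Int.lt_floor_add_one (a i * 2 ^ n)
        constructor
        · refine Int.le_floor.2 ?_
          push_cast
          linarith
        · refine Int.lt_add_one_iff.1 (Int.floor_lt.2 ?_)
          push_cast
          linarith
    exact mem_dyadicUnion.2 ⟨neighbour e p, mem_iUnion.2 ⟨e, mem_image_of_mem _ rfl⟩, he⟩
  refine (dyadicContent_le hcov).trans ((coverSum_neighbours_le t {p}).trans (le_of_eq ?_))
  congr 1
  rw [← ediam_dyadicCube_eq_ofReal n p.2, coverSum]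
  exact tsum_singleton p (cubeWeight t)

/-! ### Intersections -/

/-- A Cantor construction: each cube of a finite family is filled by cubes whose closures lie in the
next `G m`, so the content of the union never drops below that of the initial cube. Any cover of the
compact limit set, once enlarged by neighbours, already covers some finite stage. -/
theorem dyadicContent_iInter_inter_closed {t : ℝ} {G : ℕ → Set (EuclideanSpace ℝ (Fin d))}
    (hG : ∀ m, HasDyadicFillings t 1 (G m)) (n : ℤ) (k : Fin d → ℤ) :
    Metric.ediam (dyadicCube n k) ^ t ≤
      3 ^ d * dyadicContent t ((⋂ m, G m) ∩ closedDyadicCube n k) := by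
  classical
  let Fam := {S : Finset (ℤ × (Fin d → ℤ)) //
    (S : Set (ℤ × (Fin d → ℤ))).PairwiseDisjoint (fun p => dyadicCube p.1 p.2)}
  have hstep : ∀ (m : ℕ) (S : Fam), ∃ S' : Fam,
      (∀ p ∈ S'.1, (∃ q ∈ S.1, dyadicCube p.1 p.2 ⊆ dyadicCube q.1 q.2) ∧
        closedDyadicCube p.1 p.2 ⊆ G m) ∧
      dyadicContent t (dyadicUnion (d := d) S.1) ≤ dyadicContent t (dyadicUnion (d := d) S'.1) := by
    rintro m ⟨S, hS⟩
    choose R h1 h2 h3 using fun p : ℤ × (Fin d → ℤ) => hG m p.1 p.2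
    refine ⟨⟨S.biUnion R, ?_⟩, ?_, ?_⟩
    · intro p hp q hq hpq
      obtain ⟨a, ha, hpa⟩ := Finset.mem_biUnion.1 (Finset.mem_coe.1 hp)
      obtain ⟨b, hb, hqb⟩ := Finset.mem_biUnion.1 (Finset.mem_coe.1 hq)
      by_cases hab : a = b
      · subst hab
        exact h1 a hpa hqb hpq
      · exact (hS ha hb hab).mono (h2 a p hpa).1 (h2 b q hqb).1
    · intro p hp
      obtain ⟨a, ha, hpa⟩ := Finset.mem_biUnion.1 hp
      exact ⟨⟨a, ha, (h2 a p hpa).1⟩, (h2 a p hpa).2⟩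
    · refine (dyadicContent_le_of_fill hS (F := fun p => dyadicUnion (R p)) ?_ ?_).trans
        (dyadicContent_mono ?_)
      · intro p _ x hx
        obtain ⟨q, hq, hxq⟩ := mem_dyadicUnion.1 hx
        exact (h2 p q hq).1 hxq
      · intro p _
        simpa using h3 p
      · refine iUnion₂_subset fun p hp x hx => ?_
        obtain ⟨q, hq, hxq⟩ := mem_dyadicUnion.1 hx
        exact mem_dyadicUnion.2 ⟨q, Finset.mem_coe.2 (Finset.mem_biUnion.2 ⟨p, hp, hq⟩), hxq⟩
  choose next hnext hnext' using hstep
  -- The initial family serves only to lie in the given cube with full content; stage `m + 1` is the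
  -- one placed inside `G m`.
  obtain ⟨S₀, a1, a2, a3⟩ := hG 0 n k
  let Fs : ℕ → Fam := fun m => Nat.rec ⟨S₀, a1⟩ (fun m S => next m S) m
  have hFs : ∀ m, Fs (m + 1) = next m (Fs m) := fun m => rfl
  have hsub : ∀ m, dyadicUnion (d := d) (Fs (m + 1)).1 ⊆ dyadicUnion (d := d) (Fs m).1 := by
    intro m x hx
    obtain ⟨p, hp, hxp⟩ := mem_dyadicUnion.1 hx
    obtain ⟨⟨q, hq, hpq⟩, -⟩ := hnext m (Fs m) p hp
    exact mem_dyadicUnion.2 ⟨q, hq, hpq hxp⟩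
  have hinD : dyadicUnion (d := d) (Fs 0).1 ⊆ dyadicCube n k := by
    intro x hx
    obtain ⟨p, hp, hxp⟩ := mem_dyadicUnion.1 hx
    exact (a2 p hp).1 hxp
  have hcontent : ∀ m, Metric.ediam (dyadicCube n k) ^ t ≤
      dyadicContent t (dyadicUnion (d := d) (Fs m).1) := by
    intro m
    induction m with
    | zero => exact (one_mul (Metric.ediam (dyadicCube n k) ^ t)) ▸ a3
    | succ m ih => exact ih.trans (hnext' m (Fs m))
  let K : ℕ → Set (EuclideanSpace ℝ (Fin d)) := fun m => closure (dyadicUnion (d := d) (Fs m).1)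
  have hanti : Antitone K := antitone_nat_of_succ_le fun m => closure_mono (hsub m)
  have hKD : ∀ m, K m ⊆ closedDyadicCube n k := fun m =>
    (hanti (Nat.zero_le m)).trans (closure_minimal
      (hinD.trans (dyadicCube_subset_closedDyadicCube n k)) (isClosed_closedDyadicCube n k))
  have hKG : ∀ m, K (m + 1) ⊆ G m := by
    intro m
    have h1 : dyadicUnion (d := d) (Fs (m + 1)).1 ⊆
        ⋃ p ∈ (Fs (m + 1)).1, closedDyadicCube p.1 p.2 :=
      iUnion₂_mono fun p _ => dyadicCube_subset_closedDyadicCube p.1 p.2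
    refine (closure_minimal h1 ?_).trans (iUnion₂_subset fun p hp => (hnext m (Fs m) p hp).2)
    exact isClosed_biUnion_finset fun p _ => isClosed_closedDyadicCube p.1 p.2
  have hKE : ⋂ m, K m ⊆ (⋂ m, G m) ∩ closedDyadicCube n k := fun x hx =>
    ⟨mem_iInter.2 fun m => hKG m (mem_iInter.1 hx (m + 1)), hKD 0 (mem_iInter.1 hx 0)⟩
  have hmain : ∀ T, (⋂ m, G m) ∩ closedDyadicCube n k ⊆ dyadicUnion T →
      Metric.ediam (dyadicCube n k) ^ t ≤ 3 ^ d * coverSum t T := by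
    intro T hT
    let O := ⋃ p ∈ T, interior (⋃ e, dyadicCube (neighbour e p).1 (neighbour e p).2)
    have hO : IsOpen O := isOpen_biUnion fun p _ => isOpen_interior
    have hKO : ∀ x ∈ ⋂ m, K m, O ∈ 𝓝 x := by
      intro x hx
      obtain ⟨p, hp, hxp⟩ := mem_dyadicUnion.1 (hT (hKE hx))
      exact hO.mem_nhds (mem_biUnion hp (dyadicCube_subset_interior_neighbours p hxp))
    obtain ⟨m, hm⟩ := exists_subset_nhds_of_isCompact' hanti.directed_ge
      (fun m => (isCompact_closedDyadicCube n k).of_isClosed_subset isClosed_closure (hKD m))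
      (fun m => isClosed_closure) hKO
    refine ((hcontent m).trans (dyadicContent_le ?_)).trans (coverSum_neighbours_le t T)
    intro x hx
    obtain ⟨p, hp, hxp⟩ := mem_iUnion₂.1 (hm (subset_closure hx))
    obtain ⟨e, he⟩ := mem_iUnion.1 (interior_subset hxp)
    exact mem_dyadicUnion.2 ⟨_, mem_iUnion.2 ⟨e, mem_image_of_mem _ hp⟩, he⟩
  have h3 : (3 ^ d : ENNReal) ≠ 0 := by positivity
  have h3' : (3 ^ d : ENNReal) ≠ ⊤ := by simp
  rw [mul_comm, ← ENNReal.div_le_iff h3 h3']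
  refine le_dyadicContent fun T hT => ?_
  rw [ENNReal.div_le_iff h3 h3', mul_comm]
  exact hmain T hT

/-- In each coordinate this grandchild is the second of the four quarters, which stays away from
both ends of the interval. -/
theorem closedDyadicCube_subset_dyadicCube (n : ℤ) (k : Fin d → ℤ) :
    closedDyadicCube (n + 1 + 1) (fun i => 4 * k i + 1) ⊆ dyadicCube n k := by
  intro x hx i
  obtain ⟨h1, h2⟩ := hx i
  have hp : (0 : ℝ) < 2 ^ (-(n + 1 + 1)) := by positivity
  have e1 : (2 : ℝ) ^ (-n) = 4 * 2 ^ (-(n + 1 + 1)) := by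
    rw [show -n = -(n + 1 + 1) + 2 by ring, zpow_add₀ (by norm_num)]
    norm_num
    ring
  rw [e1]
  push_cast at h1 h2
  constructor <;> nlinarith

/-- Countable intersections of sets with dyadic fillings have large content in each cube. -/
theorem ediam_rpow_le_dyadicContent_iInter {t : ℝ} (ht : 0 ≤ t) (htd : t < d)
    {G : ℕ → Set (EuclideanSpace ℝ (Fin d))} (hG : ∀ m, HasDyadicFillings t 1 (G m))
    (n : ℤ) (k : Fin d → ℤ) :
    Metric.ediam (dyadicCube n k) ^ t ≤ dyadicContent t ((⋂ m, G m) ∩ dyadicCube n k) := by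
  -- The factor `3^d` is the loss from the neighbours, and `4^(-t)` that from passing to a closed
  -- grandchild inside the half-open cube. The self-improvement removes both.
  refine ediam_rpow_le_dyadicContent (c := (3 ^ d)⁻¹ * (4⁻¹) ^ t) ht htd ?_ ?_ n k
  · exact mul_ne_zero (by simp) (by simp [ENNReal.rpow_eq_zero_iff])
  · intro n k
    have h1 := dyadicContent_iInter_inter_closed hG (n + 1 + 1) (fun i => 4 * k i + 1)
    have h2 : Metric.ediam (dyadicCube (n + 1 + 1) (fun i => 4 * k i + 1)) ^ t =
        (4⁻¹) ^ t * Metric.ediam (dyadicCube n k) ^ t := by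
      rw [ediam_dyadicCube_eq_ofReal, ediam_dyadicCube_eq_ofReal, genDiam_add_one,
        genDiam_add_one, div_div, ENNReal.ofReal_div_of_pos (by norm_num),
        ← ENNReal.mul_rpow_of_ne_top (by simp) ENNReal.ofReal_ne_top, div_eq_mul_inv, mul_comm]
      norm_num
    rw [h2] at h1
    rw [mul_assoc, ← ENNReal.div_eq_inv_mul]
    refine ENNReal.div_le_of_le_mul' (h1.trans ?_)
    gcongr
    exact dyadicContent_mono (inter_subset_inter_right _ (closedDyadicCube_subset_dyadicCube n k))

end DyadicContent

/-! ### Filling cubes by subsets of the balls of a fine cover -/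

section Filling

variable {d : ℕ}

/-- The volume of the Euclidean unit ball. -/
noncomputable def unitBallVolume (d : ℕ) : ℝ :=
  (volume (Metric.ball (0 : EuclideanSpace ℝ (Fin d)) 1)).toReal

theorem unitBallVolume_pos : 0 < unitBallVolume d :=
  ENNReal.toReal_pos (Metric.measure_ball_pos volume _ one_pos).ne' measure_ball_lt_top.ne

theorem volume_ball_eq (x : EuclideanSpace ℝ (Fin d)) {r : ℝ} (hr : 0 < r) :
    volume (Metric.ball x r) = ENNReal.ofReal (r ^ d * unitBallVolume d) := by
  rw [Measure.addHaar_ball_of_pos _ _ hr, finrank_euclideanSpace_fin,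
    ENNReal.ofReal_mul (by positivity), unitBallVolume, ENNReal.ofReal_toReal
    measure_ball_lt_top.ne]

theorem volume_closedBall_eq (x : EuclideanSpace ℝ (Fin d)) {r : ℝ} (hr : 0 < r) :
    volume (Metric.closedBall x r) = ENNReal.ofReal (r ^ d * unitBallVolume d) := by
  rw [Measure.addHaar_closedBall _ _ hr.le, finrank_euclideanSpace_fin,
    ENNReal.ofReal_mul (by positivity), unitBallVolume, ENNReal.ofReal_toReal
    measure_ball_lt_top.ne]

/-- The dyadic cubes of generation `N` whose closures are subsets of an open set `V` fill half of
`V` when `N` is large. -/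
theorem eventually_half_volume_le {V : Set (EuclideanSpace ℝ (Fin d))} (hV : IsOpen V)
    (h0 : volume V ≠ 0) (h1 : volume V ≠ ⊤) :
    ∀ᶠ N : ℕ in atTop, volume V / 2 ≤ volume (V ∩ {x : EuclideanSpace ℝ (Fin d) |
      closedDyadicCube (N : ℤ) (fun i => ⌊x i * 2 ^ (N : ℤ)⌋) ⊆ V}) := by
  -- These sets exhaust `V`, so one of them carries more than half the volume; cubes smaller than
  -- its margin that meet it stay in `V`.
  let M : ℕ → Set (EuclideanSpace ℝ (Fin d)) := fun m =>
    {x | Metric.closedBall x (1 / (m + 1 : ℝ)) ⊆ V}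
  have hmono : Monotone M := fun m m' h x hx =>
    (Metric.closedBall_subset_closedBall (by gcongr)).trans hx
  have hun : ⋃ m, M m = V := by
    refine Subset.antisymm (iUnion_subset fun m x hx => hx (Metric.mem_closedBall_self
      (by positivity))) fun x hx => ?_
    obtain ⟨ε, hε, hsub⟩ := Metric.isOpen_iff.1 hV x hx
    obtain ⟨m, hm⟩ := exists_nat_one_div_lt hε
    exact mem_iUnion.2 ⟨m, (Metric.closedBall_subset_ball hm).trans hsub⟩
  have hlt : volume V / 2 < ⨆ m, volume (M m) := by
    rw [← hmono.measure_iUnion, hun]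
    exact ENNReal.half_lt_self h0 h1
  obtain ⟨m, hm⟩ := lt_iSup_iff.1 hlt
  have hlim : Tendsto (fun N : ℕ => Real.sqrt (∑ _i : Fin d, (2 ^ (-(N : ℤ)) : ℝ) ^ 2)) atTop
      (𝓝 (Real.sqrt (∑ _i : Fin d, (0 : ℝ) ^ 2))) := by
    refine (tendsto_finsetSum _ fun i _ => Tendsto.pow ?_ 2).sqrt
    simpa using tendsto_pow_atTop_nhds_zero_of_lt_one (r := (2 : ℝ)⁻¹) (by norm_num) (by norm_num)
  have hpos : Real.sqrt (∑ _i : Fin d, (0 : ℝ) ^ 2) < 1 / (m + 1 : ℝ) := by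
    simp only [ne_eq, OfNat.ofNat_ne_zero, not_false_eq_true, zero_pow, Finset.sum_const_zero,
      Real.sqrt_zero]
    positivity
  filter_upwards [hlim.eventually (gt_mem_nhds hpos)] with N hN
  refine hm.le.trans (measure_mono fun x hx => ⟨hx (Metric.mem_closedBall_self (by positivity)),
    fun z hz => hx ?_⟩)
  exact (dist_le_of_mem_closedDyadicCube hz (dyadicCube_subset_closedDyadicCube _ _
    (mem_dyadicCube_floor (N : ℤ) x))).trans hN.le

theorem finite_setOf_dyadicCube_subset (n m : ℤ) (k : Fin d → ℤ) :
    {l : Fin d → ℤ | dyadicCube m l ⊆ dyadicCube n k}.Finite := by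
  refine (finite_Icc (fun i => ⌊(k i : ℝ) * 2 ^ (-n) * 2 ^ m⌋)
    (fun i => ⌈((k i : ℝ) + 1) * 2 ^ (-n) * 2 ^ m⌉)).subset fun l hl => ?_
  obtain ⟨x, hx⟩ := dyadicCube_nonempty m l
  have hp : (0 : ℝ) < 2 ^ m := by positivity
  refine ⟨fun i => ?_, fun i => ?_⟩
  · rw [← mem_dyadicCube_iff.1 hx i]
    exact Int.floor_le_floor (mul_le_mul_of_nonneg_right (hl hx i).1 hp.le)
  · rw [← mem_dyadicCube_iff.1 hx i]
    exact (Int.floor_le_ceil _).trans (Int.ceil_le_ceil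
      (mul_le_mul_of_nonneg_right (hl hx i).2.le hp.le))

theorem volume_interior_dyadicCube (n : ℤ) (k : Fin d → ℤ) :
    ENNReal.ofReal ((2 ^ (-n)) ^ d) ≤ volume (interior (dyadicCube n k)) := by
  set O : Set (EuclideanSpace ℝ (Fin d)) :=
    {x | ∀ i, x i ∈ Ioo ((k i : ℝ) * 2 ^ (-n)) (((k i : ℝ) + 1) * 2 ^ (-n))}
  have hO : IsOpen O := by
    have : O = ⋂ i, (fun x : EuclideanSpace ℝ (Fin d) => x i) ⁻¹'
        Ioo ((k i : ℝ) * 2 ^ (-n)) (((k i : ℝ) + 1) * 2 ^ (-n)) := by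
      ext x; simp [O]
    rw [this]
    exact isOpen_iInter_of_finite fun i => isOpen_Ioo.preimage (by fun_prop)
  have hsub : O ⊆ interior (dyadicCube n k) :=
    interior_maximal (fun x hx i => Ioo_subset_Ico_self (hx i)) hO
  refine le_trans (le_of_eq ?_) (measure_mono hsub)
  have h : O = (MeasurableEquiv.toLp 2 (Fin d → ℝ)).symm ⁻¹'
      (Set.univ.pi fun i => Set.Ioo ((k i : ℝ) * 2 ^ (-n)) (((k i : ℝ) + 1) * 2 ^ (-n))) := by
    ext x; simp [O]
  rw [h, (EuclideanSpace.volume_preserving_symm_measurableEquiv_toLp (Fin d)).measure_preimage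
    (MeasurableSet.univ_pi fun i => measurableSet_Ioo).nullMeasurableSet, Real.volume_pi_Ioo]
  simp only [add_mul, one_mul, add_sub_cancel_left]
  rw [Finset.prod_const, Finset.card_univ, Fintype.card_fin, ENNReal.ofReal_pow (by positivity)]

/-- Finitely many small disjoint balls of a fine cover fill a fixed proportion of a cube. -/
theorem exists_finset_disjoint_balls {ι : Type*} [Countable ι] {y : ι → EuclideanSpace ℝ (Fin d)}
    {r : ι → ℝ} (hr : ∀ a, 0 < r a)
    (hfine : ∀ᵐ x : EuclideanSpace ℝ (Fin d), ∀ ε > 0, ∃ a, r a < ε ∧ x ∈ Metric.ball (y a) (r a))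
    {δ : ℝ} (hδ : 0 < δ) (n : ℤ) (k : Fin d → ℤ) :
    ∃ u : Finset ι, (u : Set ι).PairwiseDisjoint (fun a => Metric.ball (y a) (r a)) ∧
      (∀ a ∈ u, r a ≤ δ ∧ Metric.ball (y a) (r a) ⊆ dyadicCube n k) ∧
      ENNReal.ofReal ((2 ^ (-n)) ^ d / (2 * 5 ^ d)) ≤
        ∑ a ∈ u, volume (Metric.ball (y a) (r a)) := by
  classical
  obtain ⟨v, hvt, hvd, hv⟩ := Vitali.exists_disjoint_subfamily_covering_enlargement_closedBall
    {a : ι | r a ≤ δ ∧ Metric.closedBall (y a) (r a) ⊆ dyadicCube n k} y r δ (fun a ha => ha.1) 5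
    (by norm_num)
  have hvol : ∀ a, volume (Metric.closedBall (y a) (5 * r a)) =
      5 ^ d * volume (Metric.ball (y a) (r a)) := by
    intro a
    rw [volume_closedBall_eq _ (mul_pos (by norm_num) (hr a)), volume_ball_eq _ (hr a), mul_pow,
      mul_assoc, ENNReal.ofReal_mul (by positivity), ENNReal.ofReal_pow (by norm_num)]
    simp
  have hcov : volume (interior (dyadicCube n k)) ≤
      5 ^ d * ∑' a : v, volume (Metric.ball (y a) (r a)) := by
    calc _ ≤ volume (⋃ a ∈ v, Metric.closedBall (y a) (5 * r a)) := by
          refine measure_mono_ae ?_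
          filter_upwards [hfine] with x hx hxD
          obtain ⟨ε, hε, hsub⟩ := Metric.isOpen_iff.1 isOpen_interior x hxD
          obtain ⟨a, ha, hxa⟩ := hx (min δ (ε / 2)) (lt_min hδ (by positivity))
          have ha1 := ha.trans_le (min_le_left _ _)
          have ha2 := ha.trans_le (min_le_right _ _)
          have hball : Metric.closedBall (y a) (r a) ⊆ Metric.ball x ε := by
            intro z hz
            rw [Metric.mem_closedBall] at hz
            rw [Metric.mem_ball] at hxa ⊢
            linarith [dist_triangle_right z x (y a)]
          obtain ⟨b, hb, hab⟩ := hv a ⟨ha1.le, (hball.trans hsub).trans interior_subset⟩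
          exact mem_biUnion hb (hab (Metric.ball_subset_closedBall hxa))
      _ ≤ ∑' a : v, volume (Metric.closedBall (y a) (5 * r a)) :=
          measure_biUnion_le _ (to_countable v) _
      _ = _ := by
          rw [← ENNReal.tsum_mul_left]
          exact tsum_congr fun a => hvol a
  -- Vitali's lemma gives the proportion `1 / 5^d` for a possibly infinite family. The extra `2`
  -- makes the inequality strict, so a finite partial sum suffices.
  have hlt : ENNReal.ofReal ((2 ^ (-n)) ^ d / (2 * 5 ^ d)) <
      ∑' a : v, volume (Metric.ball (y a) (r a)) := by
    have h1 := (volume_interior_dyadicCube n k).trans hcov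
    rw [mul_comm (2 : ℝ), ← div_div]
    have h5 : (5 ^ d : ENNReal) ≠ 0 := by positivity
    have h5' : (5 ^ d : ENNReal) ≠ ⊤ := by simp
    rw [mul_comm, ← ENNReal.div_le_iff h5 h5'] at h1
    refine lt_of_lt_of_le ?_ h1
    have h2 : ENNReal.ofReal ((2 ^ (-n)) ^ d) / 5 ^ d =
        ENNReal.ofReal ((2 ^ (-n)) ^ d / 5 ^ d) := by
      rw [ENNReal.ofReal_div_of_pos (by positivity), ENNReal.ofReal_pow (p := 5) (by norm_num)]
      simp
    rw [h2]
    exact (ENNReal.ofReal_lt_ofReal_iff (by positivity)).2 (half_lt_self (by positivity))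
  rw [ENNReal.tsum_eq_iSup_sum] at hlt
  obtain ⟨w, hw⟩ := lt_iSup_iff.1 hlt
  refine ⟨w.map (Function.Embedding.subtype _), ?_, ?_, ?_⟩
  · intro a ha b hb hab
    simp only [Finset.coe_map, Function.Embedding.subtype_apply, mem_image, Finset.mem_coe,
      Subtype.exists, exists_and_right, exists_eq_right] at ha hb
    exact (hvd ha.1 hb.1 hab).mono Metric.ball_subset_closedBall Metric.ball_subset_closedBall
  · intro a ha
    simp only [Finset.mem_map, Function.Embedding.subtype_apply, Subtype.exists, exists_and_right,
      exists_eq_right] at ha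
    exact ⟨(hvt ha.1).1, Metric.ball_subset_closedBall.trans (hvt ha.1).2⟩
  · rw [Finset.sum_map]
    exact hw.le

/-- A ball of radius at least `ρ` with a point near `q` has a large part near `q`. -/
theorem volume_ball_inter_ball_ge {y p q : EuclideanSpace ℝ (Fin d)} {r ρ : ℝ} (hρ : 0 < ρ)
    (hρr : ρ ≤ r) (hp : p ∈ Metric.ball y r) (hpq : dist p q ≤ ρ) :
    ENNReal.ofReal ((ρ / 2) ^ d * unitBallVolume d) ≤
      volume (Metric.ball y r ∩ Metric.ball q (3 * ρ)) := by
  have hr : 0 < r := hρ.trans_le hρr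
  -- Moving `p` towards the centre `y` by this fraction shifts it by less than `ρ / 2` and leaves
  -- room for a ball of radius `c * r = ρ / 2` inside `Metric.ball y r`.
  set c : ℝ := ρ / (2 * r)
  have hc : 0 < c := by positivity
  have hc1 : c ≤ 1 := by
    rw [div_le_one (by positivity)]
    linarith
  have hcr : c * r = ρ / 2 := by
    simp only [c]
    field_simp
  set z := p + c • (y - p)
  have hpy : ‖p - y‖ < r := by rwa [← dist_eq_norm]
  have hzy : dist z y ≤ (1 - c) * r := by
    have : z - y = (1 - c) • (p - y) := by
      simp only [z]
      module
    rw [dist_eq_norm, this, norm_smul, Real.norm_of_nonneg (by linarith)]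
    exact mul_le_mul_of_nonneg_left hpy.le (by linarith)
  have hzp : dist z p ≤ ρ / 2 := by
    have : z - p = (-c) • (p - y) := by
      simp only [z]
      module
    rw [dist_eq_norm, this, norm_smul, norm_neg, Real.norm_of_nonneg hc.le, ← hcr]
    exact mul_le_mul_of_nonneg_left hpy.le hc.le
  rw [← volume_ball_eq z (by positivity)]
  refine measure_mono (subset_inter ?_ ?_)
  · refine Metric.ball_subset_ball' ?_
    rw [sub_mul, one_mul, hcr] at hzy
    linarith
  · refine Metric.ball_subset_ball' ?_
    linarith [dist_triangle z p q]

end Filling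

/-! ### Frostman estimates for masses spread over subsets of balls -/

section Filling

variable {d : ℕ}

/-- Bounding the mass on `Q` by the volume of a part of the ball near `Q` lets the estimates for
disjoint balls be summed without counting them. If `r < ρ`, the whole ball is near `Q`. Otherwise `ρ
≤ δ`, and the choice of `δ` turns `C * ρ ^ t'` into at most `R ^ (d - t) * ρ ^ t`. -/
theorem ball_mass_le {y q : EuclideanSpace ℝ (Fin d)} {r ρ R δ C t t' : ℝ}
    {V Q : Set (EuclideanSpace ℝ (Fin d))} (hVB : V ⊆ Metric.ball y r) (hV0 : volume V ≠ 0)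
    (hρ : 0 < ρ) (hρR : ρ ≤ R) (hC : 0 ≤ C) (htt' : t < t') (htd : t ≤ d) (hrδ : r ≤ δ)
    (hδ : C * δ ^ (t' - t) ≤ R ^ ((d : ℝ) - t)) (hq : q ∈ Q)
    (hQ : ∀ x ∈ Q, ∀ z ∈ Q, dist x z ≤ ρ)
    (hV : volume (Metric.ball y r) * volume (V ∩ Q) ≤ ENNReal.ofReal (C * ρ ^ t') * volume V) :
    volume (Metric.ball y r) / volume V * volume (V ∩ Q) ≤
      ENNReal.ofReal ((1 + 2 ^ d / unitBallVolume d) * (R / ρ) ^ ((d : ℝ) - t)) *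
        volume (Metric.ball y r ∩ Metric.ball q (3 * ρ)) := by
  have hκ := unitBallVolume_pos (d := d)
  have hV1 : volume V ≠ ⊤ := ((measure_mono hVB).trans_lt measure_ball_lt_top).ne
  have hX : 1 ≤ (R / ρ) ^ ((d : ℝ) - t) :=
    Real.one_le_rpow ((one_le_div hρ).2 hρR) (by linarith)
  rcases (V ∩ Q).eq_empty_or_nonempty with he | ⟨p, hpV, hpQ⟩
  · rw [he]
    simp
  rcases lt_or_ge r ρ with h | h
  · have hsub : Metric.ball y r ⊆ Metric.ball q (3 * ρ) := by
      intro z hz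
      have h1 := hVB hpV
      rw [Metric.mem_ball] at hz h1 ⊢
      linarith [dist_triangle_right z p y, dist_triangle z p q, hQ p hpQ q hq]
    rw [inter_eq_left.2 hsub]
    calc _ ≤ volume (Metric.ball y r) / volume V * volume V := by
          gcongr; exact inter_subset_left
      _ = 1 * volume (Metric.ball y r) := by rw [ENNReal.div_mul_cancel hV0 hV1, one_mul]
      _ ≤ _ := by
          gcongr
          rw [ENNReal.one_le_ofReal]
          refine one_le_mul_of_one_le_of_one_le ?_ hX
          linarith [show 0 < 2 ^ d / unitBallVolume d by positivity]
  · refine le_trans ?_ (mul_le_mul_right (volume_ball_inter_ball_ge hρ h (hVB hpV)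
      (hQ p hpQ q hq)) _)
    rw [← ENNReal.mul_div_right_comm]
    refine (ENNReal.div_le_of_le_mul hV).trans ?_
    rw [← ENNReal.ofReal_mul (by positivity)]
    refine ENNReal.ofReal_le_ofReal ?_
    have hR : 0 < R := hρ.trans_le hρR
    have hρδ : ρ ≤ δ := h.trans hrδ
    have e1 : ρ ^ t' = ρ ^ (t' - t) * ρ ^ t := by rw [← Real.rpow_add hρ]; ring_nf
    have e2 : ρ ^ d = ρ ^ ((d : ℝ) - t) * ρ ^ t := by
      rw [← Real.rpow_add hρ, ← Real.rpow_natCast]; ring_nf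
    calc C * ρ ^ t' = C * ρ ^ (t' - t) * ρ ^ t := by rw [e1]; ring
      _ ≤ C * δ ^ (t' - t) * ρ ^ t := by
          gcongr
      _ ≤ R ^ ((d : ℝ) - t) * ρ ^ t := by gcongr
      _ = (2 ^ d / unitBallVolume d) * (R / ρ) ^ ((d : ℝ) - t) *
          ((ρ / 2) ^ d * unitBallVolume d) := by
          rw [Real.div_rpow hR.le hρ.le, div_pow, e2]
          have : ρ ^ ((d : ℝ) - t) ≠ 0 := (Real.rpow_pos_of_pos hρ _).ne'
          field_simp
      _ ≤ _ := by
          gcongr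
          linarith

/-- The sets `V a` fill the dyadic cubes if the balls that contain them form a fine cover, and if
the mass of each ball, spread evenly over `V a`, satisfies a Frostman condition. -/
theorem hasDyadicFillings_iUnion (hd : 1 ≤ d) {ι : Type*} [Countable ι]
    {y : ι → EuclideanSpace ℝ (Fin d)} {r : ι → ℝ} {V : ι → Set (EuclideanSpace ℝ (Fin d))}
    {t t' C : ℝ} (ht : 0 ≤ t) (htt' : t < t') (htd : t ≤ d) (hC : 0 ≤ C) (hr : ∀ a, 0 < r a)
    (hVo : ∀ a, IsOpen (V a)) (hVn : ∀ a, (V a).Nonempty)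
    (hVB : ∀ a, V a ⊆ Metric.ball (y a) (r a))
    (hV : ∀ a n k, volume (Metric.ball (y a) (r a)) * volume (V a ∩ dyadicCube n k) ≤
      ENNReal.ofReal (C * genDiam d n ^ t') * volume (V a))
    (hfine : ∀ᵐ x : EuclideanSpace ℝ (Fin d), ∀ ε > 0, ∃ a, r a < ε ∧
      x ∈ Metric.ball (y a) (r a)) :
    ∃ c, c ≠ 0 ∧ HasDyadicFillings t c (⋃ a, V a) := by
  classical
  set κ := unitBallVolume d
  have hκ : 0 < κ := unitBallVolume_pos
  set Δ := unitDiam d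
  have hΔ : 0 < Δ := unitDiam_pos hd
  -- The first summand serves dyadic cubes larger than the given one, the second those that are no
  -- larger.
  set C₁ : ℝ := (Δ ^ d)⁻¹ + (1 + 2 ^ d / κ) * (3 ^ d * κ)
  have hC₁ : 0 < C₁ := by positivity
  have hV0 : ∀ a, volume (V a) ≠ 0 := fun a => ((hVo a).measure_pos volume (hVn a)).ne'
  have hV1 : ∀ a, volume (V a) ≠ ⊤ := fun a =>
    ((measure_mono (hVB a)).trans_lt measure_ball_lt_top).ne
  refine ⟨ENNReal.ofReal ((4 * 5 ^ d * Δ ^ d * C₁)⁻¹), by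
    rw [ne_eq, ENNReal.ofReal_eq_zero, not_le]; positivity, fun n k => ?_⟩
  set R := genDiam d n with hRdef
  have hR : 0 < R := genDiam_pos hd n
  -- The bound `δ` on the radii depends on the cube and on `C`, but the final constant `c` depends
  -- on neither. This is where `t < t'` is needed.
  obtain ⟨δ, hδ0, hδ⟩ : ∃ δ : ℝ, 0 < δ ∧ C * δ ^ (t' - t) ≤ R ^ ((d : ℝ) - t) := by
    have h1 : 0 < t' - t := by linarith
    have hlim : Tendsto (fun δ : ℝ => C * δ ^ (t' - t)) (𝓝[>] 0) (𝓝 (C * 0 ^ (t' - t))) :=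
      (((Real.continuousAt_rpow_const 0 (t' - t) (Or.inr h1.le)).tendsto).const_mul C).mono_left
        nhdsWithin_le_nhds
    rw [Real.zero_rpow h1.ne', mul_zero] at hlim
    obtain ⟨δ, h2, h3⟩ := ((hlim.eventually (gt_mem_nhds (Real.rpow_pos_of_pos hR
      ((d : ℝ) - t)))).and self_mem_nhdsWithin).exists
    exact ⟨δ, h3, h2.le⟩
  obtain ⟨u, hud, hu, husum⟩ := exists_finset_disjoint_balls hr hfine hδ0 n k
  set w : ι → ENNReal := fun a => volume (Metric.ball (y a) (r a)) / volume (V a)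
  set μ : Measure (EuclideanSpace ℝ (Fin d)) := ∑ a ∈ u, w a • volume.restrict (V a)
  have hμ : ∀ s, MeasurableSet s → μ s = ∑ a ∈ u, w a * volume (V a ∩ s) := by
    intro s hs
    simp only [μ, Measure.finsetSum_apply, Measure.smul_apply, smul_eq_mul]
    refine Finset.sum_congr rfl fun a _ => ?_
    rw [Measure.restrict_apply hs, inter_comm]
  have hwV : ∀ a, w a * volume (V a) = volume (Metric.ball (y a) (r a)) := fun a =>
    ENNReal.div_mul_cancel (hV0 a) (hV1 a)
  have hRd : (2 ^ (-n) : ℝ) ^ d = (Δ ^ d)⁻¹ * R ^ ((d : ℝ) - t) * R ^ t := by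
    rw [mul_assoc, ← Real.rpow_add hR, sub_add_cancel, Real.rpow_natCast, hRdef, genDiam, mul_pow]
    field_simp
    simp only [Δ]
  have hsum_le : ∀ s, MeasurableSet s → ∑ a ∈ u, volume (Metric.ball (y a) (r a) ∩ s) ≤
      volume s := by
    intro s hs
    rw [← measure_biUnion_finset (fun a ha b hb hab =>
      (hud ha hb hab).mono inter_subset_left inter_subset_left)
      fun a _ => Metric.isOpen_ball.measurableSet.inter hs]
    exact measure_mono (iUnion₂_subset fun a _ => inter_subset_right)
  have hfrost : ∀ m l, μ (dyadicCube m l) ≤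
      ENNReal.ofReal (C₁ * R ^ ((d : ℝ) - t)) * Metric.ediam (dyadicCube m l) ^ t := by
    intro m l
    set ρ := genDiam d m
    have hρ : 0 < ρ := genDiam_pos hd m
    rw [hμ _ (measurableSet_dyadicCube m l), ediam_dyadicCube_eq_ofReal,
      ENNReal.ofReal_rpow_of_pos hρ, ← ENNReal.ofReal_mul (by positivity)]
    rcases le_or_gt ρ R with h | h
    · obtain ⟨q, hq⟩ := dyadicCube_nonempty m l
      calc _ ≤ ∑ a ∈ u, ENNReal.ofReal ((1 + 2 ^ d / κ) * (R / ρ) ^ ((d : ℝ) - t)) *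
              volume (Metric.ball (y a) (r a) ∩ Metric.ball q (3 * ρ)) :=
            Finset.sum_le_sum fun a ha => ball_mass_le (hVB a) (hV0 a) hρ h hC htt' htd
              (hu a ha).1 hδ hq (fun x hx z hz => dist_le_genDiam hx hz) (hV a m l)
        _ ≤ ENNReal.ofReal ((1 + 2 ^ d / κ) * (R / ρ) ^ ((d : ℝ) - t)) *
              volume (Metric.ball q (3 * ρ)) := by
            rw [← Finset.mul_sum]
            gcongr
            exact hsum_le _ Metric.isOpen_ball.measurableSet
        _ ≤ _ := by
            rw [volume_ball_eq _ (by positivity), ← ENNReal.ofReal_mul (by positivity)]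
            refine ENNReal.ofReal_le_ofReal ?_
            have e2 : ρ ^ d = ρ ^ ((d : ℝ) - t) * ρ ^ t := by
              rw [← Real.rpow_add hρ, ← Real.rpow_natCast]; ring_nf
            calc _ = (1 + 2 ^ d / κ) * (3 ^ d * κ) * R ^ ((d : ℝ) - t) * ρ ^ t := by
                  rw [Real.div_rpow hR.le hρ.le, mul_pow, e2]
                  have : ρ ^ ((d : ℝ) - t) ≠ 0 := (Real.rpow_pos_of_pos hρ _).ne'
                  simp only [← show κ = unitBallVolume d from rfl]
                  field_simp
              _ ≤ _ := by
                  gcongr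
                  exact le_add_of_nonneg_left (by positivity)
    · calc _ ≤ ∑ a ∈ u, volume (Metric.ball (y a) (r a) ∩ dyadicCube n k) := by
            refine Finset.sum_le_sum fun a ha => ?_
            rw [inter_eq_left.2 (hu a ha).2, ← hwV a]
            gcongr
            exact inter_subset_left
        _ ≤ volume (dyadicCube n k) := hsum_le _ (measurableSet_dyadicCube n k)
        _ ≤ _ := by
            rw [volume_dyadicCube, hRd]
            refine ENNReal.ofReal_le_ofReal ?_
            gcongr
            exact le_add_of_nonneg_right (by positivity)
  obtain ⟨N, hN⟩ := ((Filter.eventually_all_finset u).2 fun a _ =>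
    eventually_half_volume_le (hVo a) (hV0 a) (hV1 a)).exists
  -- At generation `N` these cubes carry at least half the mass of every chosen `V a`, which
  -- accounts for `4` in place of `2` in the final constant.
  set S : Finset (ℤ × (Fin d → ℤ)) :=
    ((finite_setOf_dyadicCube_subset n N k).toFinset.filter fun l =>
      ∃ a ∈ u, closedDyadicCube (N : ℤ) l ⊆ V a).image fun l => ((N : ℤ), l)
  have hS : ∀ p, p ∈ S ↔ ∃ l, (dyadicCube (N : ℤ) l ⊆ dyadicCube n k ∧
      ∃ a ∈ u, closedDyadicCube (N : ℤ) l ⊆ V a) ∧ ((N : ℤ), l) = p := by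
    intro p
    simp only [S, Finset.mem_image, Finset.mem_filter, Finite.mem_toFinset, mem_ofPred_eq]
  refine ⟨S, ?_, ?_, ?_⟩
  · intro p hp q hq hpq
    obtain ⟨l, -, rfl⟩ := (hS p).1 hp
    obtain ⟨l', -, rfl⟩ := (hS q).1 hq
    exact dyadicCube_disjoint fun h => hpq (Prod.ext rfl h)
  · intro p hp
    obtain ⟨l, ⟨h1, a, ha, h2⟩, rfl⟩ := (hS p).1 hp
    exact ⟨h1, h2.trans (subset_iUnion V a)⟩
  have hmeas : MeasurableSet (dyadicUnion (d := d) S) :=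
    Finset.measurableSet_biUnion S fun p _ => measurableSet_dyadicCube p.1 p.2
  have hmass : ENNReal.ofReal ((2 ^ (-n)) ^ d / (4 * 5 ^ d)) ≤ μ (dyadicUnion (d := d) S) := by
    calc _ = ENNReal.ofReal ((2 ^ (-n)) ^ d / (2 * 5 ^ d)) / 2 := by
          rw [← ENNReal.ofReal_ofNat 2, ← ENNReal.ofReal_div_of_pos two_pos, div_div]
          ring_nf
      _ ≤ (∑ a ∈ u, volume (Metric.ball (y a) (r a))) / 2 := by gcongr
      _ = ∑ a ∈ u, w a * (volume (V a) / 2) := by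
          rw [div_eq_mul_inv, Finset.sum_mul]
          refine Finset.sum_congr rfl fun a _ => ?_
          rw [← hwV a, mul_assoc, ← div_eq_mul_inv]
      _ ≤ ∑ a ∈ u, w a * volume (V a ∩ dyadicUnion (d := d) S) := by
          refine Finset.sum_le_sum fun a ha => ?_
          gcongr
          refine (hN a ha).trans (measure_mono (inter_subset_inter_right _ fun x hx => ?_))
          have hx' := mem_dyadicCube_floor (N : ℤ) x
          refine mem_dyadicUnion.2 ⟨_, (hS _).2 ⟨_, ⟨?_, a, ha, hx⟩, rfl⟩, hx'⟩
          exact (dyadicCube_subset_closedDyadicCube _ _).trans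
            ((hx.trans (hVB a)).trans (hu a ha).2)
      _ = _ := (hμ _ hmeas).symm
  refine le_trans ?_ (measure_div_le_dyadicContent μ hfrost _)
  have hpos : 0 < C₁ * R ^ ((d : ℝ) - t) := mul_pos hC₁ (Real.rpow_pos_of_pos hR _)
  rw [ENNReal.le_div_iff_mul_le (Or.inl (ENNReal.ofReal_pos.2 hpos).ne')
    (Or.inl ENNReal.ofReal_ne_top)]
  refine le_trans (le_of_eq ?_) hmass
  rw [ediam_dyadicCube_eq_ofReal, ENNReal.ofReal_rpow_of_pos hR,
    ← ENNReal.ofReal_mul (by positivity), ← ENNReal.ofReal_mul (by positivity), hRd]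
  congr 1
  field_simp

end Filling

/-! ### Ellipsoids and rectangles -/

namespace PrincipalAxes

variable {d : ℕ}

/-- The rectangle with the semi-axes `A.semiAxis i / d`. -/
def core (A : PrincipalAxes d) : Set (EuclideanSpace ℝ (Fin d)) :=
  {y | ∀ i, |inner ℝ (A.dir i) (y - A.center)| < A.semiAxis i / d}

theorem volume_orthonormal_box (b : OrthonormalBasis (Fin d) ℝ (EuclideanSpace ℝ (Fin d)))
    (l u : Fin d → ℝ) :
    volume {y : EuclideanSpace ℝ (Fin d) | ∀ i, inner ℝ (b i) y ∈ Ioo (l i) (u i)} =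
      ∏ i, ENNReal.ofReal (u i - l i) := by
  have h : {y : EuclideanSpace ℝ (Fin d) | ∀ i, inner ℝ (b i) y ∈ Ioo (l i) (u i)} =
      b.repr ⁻¹' ((MeasurableEquiv.toLp 2 (Fin d → ℝ)).symm ⁻¹'
        (Set.univ.pi fun i => Ioo (l i) (u i))) := by
    ext x; simp [b.repr_apply_apply]
  have hm : MeasurableSet (Set.univ.pi fun i => Ioo (l i) (u i)) :=
    MeasurableSet.univ_pi fun i => measurableSet_Ioo
  rw [h, b.measurePreserving_repr.measure_preimage
    ((MeasurableEquiv.toLp 2 (Fin d → ℝ)).symm.measurable hm).nullMeasurableSet,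
    (EuclideanSpace.volume_preserving_symm_measurableEquiv_toLp (Fin d)).measure_preimage
    hm.nullMeasurableSet, Real.volume_pi_Ioo]

theorem volume_core (A : PrincipalAxes d) :
    volume A.core = ∏ i, ENNReal.ofReal (2 * (A.semiAxis i / d)) := by
  have : A.core = {y | ∀ i, inner ℝ (A.dir i) y ∈
      Ioo (inner ℝ (A.dir i) A.center - A.semiAxis i / d)
        (inner ℝ (A.dir i) A.center + A.semiAxis i / d)} := by
    ext y
    refine forall_congr' fun i => ?_
    rw [inner_sub_right, abs_lt, mem_Ioo]
    constructor <;> rintro ⟨h1, h2⟩ <;> constructor <;> linarith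
  rw [this, volume_orthonormal_box]
  refine Finset.prod_congr rfl fun i _ => ?_
  ring_nf

theorem volume_rectangle_inter_le (A : PrincipalAxes d) {Q : Set (EuclideanSpace ℝ (Fin d))}
    {ρ : ℝ} (hρ : 0 < ρ) (hQ : ∀ x ∈ Q, ∀ y ∈ Q, dist x y ≤ ρ) :
    volume (A.rectangle ∩ Q) ≤ ∏ i, ENNReal.ofReal (4 * min (A.semiAxis i) ρ) := by
  rcases Q.eq_empty_or_nonempty with rfl | ⟨q, hq⟩
  · simp
  -- Short axes are bounded by the rectangle, long ones by `Q`. The margin `2 * ρ` is used because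
  -- distances in `Q` may equal `ρ`, while the intervals are open.
  let l : Fin d → ℝ := fun i => if A.semiAxis i ≤ ρ then
    inner ℝ (A.dir i) A.center - A.semiAxis i else inner ℝ (A.dir i) q - 2 * ρ
  let u : Fin d → ℝ := fun i => if A.semiAxis i ≤ ρ then
    inner ℝ (A.dir i) A.center + A.semiAxis i else inner ℝ (A.dir i) q + 2 * ρ
  calc _ ≤ volume {y : EuclideanSpace ℝ (Fin d) | ∀ i, inner ℝ (A.dir i) y ∈ Ioo (l i) (u i)} := by
        refine measure_mono fun y hy i => ?_
        have h1 := hy.1 i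
        rw [inner_sub_right, abs_lt] at h1
        have h2 : |inner ℝ (A.dir i) (y - q)| ≤ ρ := by
          refine (abs_real_inner_le_norm _ _).trans ?_
          rw [A.dir.norm_eq_one, one_mul, ← dist_eq_norm]
          exact hQ y hy.2 q hq
        rw [inner_sub_right, abs_le] at h2
        simp only [l, u]
        split_ifs <;> constructor <;> linarith
    _ = ∏ i, ENNReal.ofReal (u i - l i) := volume_orthonormal_box _ _ _
    _ ≤ _ := by
        refine Finset.prod_le_prod' fun i _ => ENNReal.ofReal_le_ofReal ?_
        have := A.semiAxis_pos i
        simp only [l, u]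
        split_ifs with h
        · rw [min_eq_left h]
          linarith
        · rw [min_eq_right (not_le.1 h).le]
          linarith

theorem ceil_sub_one_lt {t : ℝ} (ht : 0 < t) (htd : t ≤ d) :
    ⌈t⌉₊ - 1 < d ∧ ((⌈t⌉₊ - 1 : ℕ) : ℝ) < t ∧ t ≤ ((⌈t⌉₊ - 1 : ℕ) : ℝ) + 1 := by
  have h1 : 0 < ⌈t⌉₊ := Nat.ceil_pos.2 ht
  have h2 : ⌈t⌉₊ ≤ d := Nat.ceil_le.2 htd
  refine ⟨by omega, ?_, ?_⟩
  · exact Nat.lt_ceil.1 (by omega)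
  · have h3 : ((⌈t⌉₊ - 1 : ℕ) : ℝ) + 1 = ⌈t⌉₊ := by
      rw [← Nat.cast_add_one, Nat.sub_add_cancel h1]
    rw [h3]
    exact Nat.le_ceil t

theorem singularValue_pos (A : PrincipalAxes d) (t : ℝ) : 0 < A.singularValue t := by
  refine mul_pos (Finset.prod_pos fun i _ => ?_) ?_
  · split_ifs
    · exact A.semiAxis_pos i
    · exact one_pos
  · split_ifs
    · exact Real.rpow_pos_of_pos (A.semiAxis_pos _) _
    · exact one_pos

theorem min_one_le_rpow {x s : ℝ} (hx : 0 < x) (hs : 0 ≤ s) (hs1 : s ≤ 1) : min 1 x ≤ x ^ s := by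
  rcases le_total x 1 with h | h
  · rw [min_eq_right h]
    exact Real.self_le_rpow_of_le_one hx.le h hs1
  · rw [min_eq_left h]
    exact Real.one_le_rpow h hs

/-- The inequality holds factor by factor: the first `m` axes contribute at most `ρ` each, the next
one at most `ρ ^ (t - m)` because `0 < t - m ≤ 1`, and the remaining ones at most `1`. -/
theorem singularValue_mul_prod_le (A : PrincipalAxes d) {t ρ : ℝ} (ht : 0 < t) (htd : t ≤ d)
    (hρ : 0 < ρ) : A.singularValue t * ∏ i, min 1 (ρ / A.semiAxis i) ≤ ρ ^ t := by
  obtain ⟨hm, hm1, hm2⟩ := ceil_sub_one_lt ht htd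
  unfold singularValue
  simp only
  set m := ⌈t⌉₊ - 1
  rw [dif_pos hm]
  have e1 : A.semiAxis ⟨m, hm⟩ ^ (t - (m : ℝ)) =
      ∏ i, if i = ⟨m, hm⟩ then A.semiAxis i ^ (t - (m : ℝ)) else 1 := by
    rw [Finset.prod_ite_eq' Finset.univ]
    simp
  have e2 : ρ ^ t = (∏ i : Fin d, if (i : ℕ) < m then ρ else 1) *
      ∏ i : Fin d, if i = ⟨m, hm⟩ then ρ ^ (t - (m : ℝ)) else 1 := by
    rw [Finset.prod_ite_eq' Finset.univ]
    rw [Fin.prod_univ_eq_prod_range (fun i => if i < m then ρ else 1) d, Finset.prod_ite]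
    have : (Finset.range d).filter (fun i => i < m) = Finset.range m := by
      ext i
      simp only [Finset.mem_filter, Finset.mem_range]
      omega
    rw [this]
    simp only [Finset.prod_const, Finset.card_range, one_pow, mul_one, Finset.mem_univ, if_true]
    rw [← Real.rpow_natCast, ← Real.rpow_add hρ]
    ring_nf
  rw [e1, e2, ← Finset.prod_mul_distrib, ← Finset.prod_mul_distrib, ← Finset.prod_mul_distrib]
  refine Finset.prod_le_prod (fun i _ => ?_) fun i _ => ?_
  · have := A.semiAxis_pos i
    have h2 := Real.rpow_pos_of_pos this (t - (m : ℝ))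
    refine mul_nonneg (mul_nonneg ?_ ?_) (le_min zero_le_one (by positivity)) <;> split_ifs <;>
      first | exact zero_le_one | positivity
  · have hp := A.semiAxis_pos i
    by_cases h1 : (i : ℕ) < m
    · have h2 : i ≠ ⟨m, hm⟩ := fun h => by simp [h] at h1
      rw [if_pos h1, if_neg h2, if_pos h1, if_neg h2, mul_one, mul_one]
      calc _ ≤ A.semiAxis i * (ρ / A.semiAxis i) := by gcongr; exact min_le_right _ _
        _ = ρ := by field_simp
    · rw [if_neg h1, if_neg h1, one_mul, one_mul]
      split_ifs with h2
      · calc _ ≤ A.semiAxis i ^ (t - (m : ℝ)) * (ρ / A.semiAxis i) ^ (t - (m : ℝ)) := by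
              gcongr
              exact min_one_le_rpow (by positivity) (by linarith) (by linarith)
          _ = ρ ^ (t - (m : ℝ)) := by
              rw [← Real.mul_rpow hp.le (by positivity)]
              congr 1
              field_simp
      · rw [one_mul]
        exact min_le_left _ _

/-- The Frostman condition for the uniform distribution on a set between `A.core` and
`A.rectangle`. -/
theorem singularValue_mul_volume_inter_le (hd : 1 ≤ d) (A : PrincipalAxes d)
    {U Q : Set (EuclideanSpace ℝ (Fin d))} (hcore : A.core ⊆ U) (hrect : U ⊆ A.rectangle)
    {t ρ : ℝ} (ht : 0 < t) (htd : t ≤ d) (hρ : 0 < ρ) (hQ : ∀ x ∈ Q, ∀ y ∈ Q, dist x y ≤ ρ) :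
    ENNReal.ofReal (A.singularValue t) * volume (U ∩ Q) ≤
      ENNReal.ofReal ((2 * d) ^ d * ρ ^ t) * volume U := by
  have hd0 : (0 : ℝ) < d := by exact_mod_cast hd
  calc _ ≤ ENNReal.ofReal (A.singularValue t) *
        ∏ i, ENNReal.ofReal (4 * min (A.semiAxis i) ρ) := by
        gcongr
        exact (measure_mono (inter_subset_inter_left _ hrect)).trans
          (A.volume_rectangle_inter_le hρ hQ)
    -- Each factor is split so that the side `2 * (A.semiAxis i / d)` of the core separates off; the
    -- product of these sides is at most `volume U`.
    _ = ENNReal.ofReal (A.singularValue t) * ∏ i, (ENNReal.ofReal (2 * d) *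
          ENNReal.ofReal (min 1 (ρ / A.semiAxis i)) *
            ENNReal.ofReal (2 * (A.semiAxis i / d))) := by
        congr 1
        refine Finset.prod_congr rfl fun i _ => ?_
        have hp := A.semiAxis_pos i
        rw [← ENNReal.ofReal_mul (by positivity), ← ENNReal.ofReal_mul (by positivity)]
        congr 1
        have : min (A.semiAxis i) ρ = A.semiAxis i * min 1 (ρ / A.semiAxis i) := by
          rw [mul_min_of_nonneg _ _ hp.le, mul_one]
          congr 1
          field_simp
        rw [this]
        field_simp
        ring
    _ = ENNReal.ofReal ((2 * d) ^ d * (A.singularValue t * ∏ i, min 1 (ρ / A.semiAxis i))) *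
          volume A.core := by
        rw [Finset.prod_mul_distrib, Finset.prod_mul_distrib, Finset.prod_const, Finset.card_univ,
          Fintype.card_fin, A.volume_core,
          ENNReal.ofReal_mul (p := (2 * (d : ℝ)) ^ d) (by positivity),
          ENNReal.ofReal_mul (A.singularValue_pos t).le, ENNReal.ofReal_pow (by positivity),
          ENNReal.ofReal_prod_of_nonneg fun i _ => le_min zero_le_one
            (div_pos hρ (A.semiAxis_pos i)).le]
        ring
    _ ≤ _ := by
        gcongr
        exact A.singularValue_mul_prod_le ht htd hρ

theorem center_mem_core (hd : 1 ≤ d) (A : PrincipalAxes d) : A.center ∈ A.core := by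
  intro i
  have hd0 : (0 : ℝ) < d := by exact_mod_cast hd
  rw [sub_self, inner_zero_right, abs_zero]
  exact div_pos (A.semiAxis_pos i) hd0

theorem core_subset_rectangle (hd : 1 ≤ d) (A : PrincipalAxes d) : A.core ⊆ A.rectangle :=
  fun _ hy i => (hy i).trans_le (div_le_self (A.semiAxis_pos i).le (by exact_mod_cast hd))

/-- Each of the `d` squares is less than `1 / d^2`. Enclosing the ellipsoid between two rectangles
allows both shapes to be treated at once. -/
theorem core_subset_ellipsoid (hd : 1 ≤ d) (A : PrincipalAxes d) : A.core ⊆ A.ellipsoid := by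
  intro y hy
  have hd0 : (0 : ℝ) < d := by exact_mod_cast hd
  have hd1 : (1 : ℝ) ≤ d := by exact_mod_cast hd
  have : Nonempty (Fin d) := ⟨⟨0, hd⟩⟩
  calc _ < ∑ _i : Fin d, (1 / (d : ℝ)) ^ 2 := by
        refine Finset.sum_lt_sum_of_nonempty Finset.univ_nonempty fun i _ => ?_
        have hp := A.semiAxis_pos i
        rw [sq_lt_sq, abs_div, abs_of_pos hp, abs_of_pos (one_div_pos.2 hd0), div_lt_iff₀ hp]
        have := hy i
        rwa [div_mul_eq_mul_div, one_mul]
    _ ≤ 1 := by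
        rw [Finset.sum_const, Finset.card_univ, Fintype.card_fin, nsmul_eq_mul]
        field_simp
        linarith

theorem ellipsoid_subset_rectangle (A : PrincipalAxes d) : A.ellipsoid ⊆ A.rectangle := by
  intro y hy i
  have hp := A.semiAxis_pos i
  have h1 : (inner ℝ (A.dir i) (y - A.center) / A.semiAxis i) ^ 2 < 1 :=
    (Finset.single_le_sum (f := fun i => (inner ℝ (A.dir i) (y - A.center) / A.semiAxis i) ^ 2)
      (fun i _ => sq_nonneg _) (Finset.mem_univ i)).trans_lt hy
  rwa [sq_lt_one_iff_abs_lt_one, abs_div, abs_of_pos hp, div_lt_one hp] at h1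

theorem isOpen_rectangle (A : PrincipalAxes d) : IsOpen A.rectangle := by
  have : A.rectangle = ⋂ i, {y | |inner ℝ (A.dir i) (y - A.center)| < A.semiAxis i} := by
    ext y; simp [rectangle]
  rw [this]
  exact isOpen_iInter_of_finite fun i => isOpen_lt (by fun_prop) (by fun_prop)

theorem isOpen_ellipsoid (A : PrincipalAxes d) : IsOpen A.ellipsoid :=
  isOpen_lt (by fun_prop) (by fun_prop)

theorem inner_combination_sub {A : PrincipalAxes d} {y : EuclideanSpace ℝ (Fin d)} {a b : ℝ}
    (hab : a + b = 1) (i : Fin d) :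
    inner ℝ (A.dir i) (a • A.center + b • y - A.center) =
      b * inner ℝ (A.dir i) (y - A.center) := by
  have : a • A.center + b • y - A.center = b • (y - A.center) := by
    rw [← eq_sub_iff_add_eq] at hab
    subst hab
    module
  rw [this, inner_smul_right]

/-- Star convexity provides the connectedness that confines the set to a single lift of its ball. -/
theorem starConvex_rectangle (A : PrincipalAxes d) : StarConvex ℝ A.center A.rectangle := by
  intro y hy a b ha hb hab i
  rw [inner_combination_sub hab, abs_mul, abs_of_nonneg hb]
  exact (mul_le_of_le_one_left (abs_nonneg _) (by linarith)).trans_lt (hy i)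

theorem starConvex_ellipsoid (A : PrincipalAxes d) : StarConvex ℝ A.center A.ellipsoid := by
  intro y hy a b ha hb hab
  have hy' : ∑ i, (inner ℝ (A.dir i) (y - A.center) / A.semiAxis i) ^ 2 < 1 := hy
  refine lt_of_le_of_lt (Finset.sum_le_sum fun i _ => ?_) hy'
  rw [inner_combination_sub hab, mul_div_assoc, mul_pow]
  exact mul_le_of_le_one_left (sq_nonneg _) (pow_le_one₀ hb (by linarith))

end PrincipalAxes

/-! ### The torus -/

section TorusGeometry

variable {d : ℕ}

/-- The lattice point with integer coordinates `z`. -/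
noncomputable def latticePoint (z : Fin d → ℤ) : EuclideanSpace ℝ (Fin d) :=
  WithLp.toLp 2 fun i => (z i : ℝ)

theorem mem_integerLattice_iff {x : EuclideanSpace ℝ (Fin d)} :
    x ∈ integerLattice d ↔ ∃ z, x = latticePoint z := by
  constructor
  · intro h
    choose z hz using (show ∀ i, ∃ n : ℤ, x i = n from h)
    exact ⟨z, by ext i; exact hz i⟩
  · rintro ⟨z, rfl⟩ i
    exact ⟨z i, rfl⟩

theorem latticePoint_sub (z w : Fin d → ℤ) :
    latticePoint (z - w) = latticePoint z - latticePoint w := by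
  ext i; simp [latticePoint]

theorem latticePoint_neg (z : Fin d → ℤ) : latticePoint (-z) = -latticePoint z := by
  ext i; simp [latticePoint]

theorem torusProj_eq_iff {a b : EuclideanSpace ℝ (Fin d)} :
    torusProj d a = torusProj d b ↔ ∃ z, a = b + latticePoint z := by
  rw [torusProj, torusProj, eq_comm, QuotientAddGroup.eq, mem_integerLattice_iff]
  refine exists_congr fun z => ?_
  rw [neg_add_eq_iff_eq_add]

theorem torusProj_add_latticePoint (a : EuclideanSpace ℝ (Fin d)) (z : Fin d → ℤ) :
    torusProj d (a + latticePoint z) = torusProj d a := torusProj_eq_iff.2 ⟨z, rfl⟩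

theorem torusProj_surjective : Function.Surjective (torusProj d) :=
  QuotientAddGroup.mk_surjective

theorem continuous_torusProj : Continuous (torusProj d) := continuous_quotient_mk'

theorem isOpenMap_torusProj : IsOpenMap (torusProj d) := QuotientAddGroup.isOpenMap_coe

theorem dist_torusProj_lt_iff {a b : EuclideanSpace ℝ (Fin d)} {r : ℝ} :
    dist (torusProj d a) (torusProj d b) < r ↔ ∃ z, dist a (b + latticePoint z) < r := by
  have h : torusProj d a - torusProj d b = torusProj d (a - b) := rfl
  rw [dist_eq_norm, h, torusProj, QuotientAddGroup.norm_lt_iff]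
  constructor
  · rintro ⟨m, hm, hr⟩
    obtain ⟨z, rfl⟩ := torusProj_eq_iff.1 (show torusProj d m = torusProj d (a - b) from hm)
    refine ⟨-z, ?_⟩
    rw [dist_eq_norm, latticePoint_neg]
    convert hr using 2
    abel
  · rintro ⟨z, hz⟩
    refine ⟨a - b + latticePoint (-z), torusProj_add_latticePoint _ _, ?_⟩
    rw [dist_eq_norm] at hz
    rw [latticePoint_neg]
    convert hz using 2
    abel

theorem torusProj_mem_ball_iff {a b : EuclideanSpace ℝ (Fin d)} {r : ℝ} :
    torusProj d a ∈ Metric.ball (torusProj d b) r ↔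
      ∃ z, a ∈ Metric.ball (b + latticePoint z) r := dist_torusProj_lt_iff

theorem one_le_norm_latticePoint {z : Fin d → ℤ} (hz : z ≠ 0) : 1 ≤ ‖latticePoint z‖ := by
  obtain ⟨i, hi⟩ := Function.ne_iff.1 hz
  have h1 : ‖(latticePoint z) i‖ ≤ ‖latticePoint z‖ := PiLp.norm_apply_le _ i
  refine le_trans ?_ h1
  have : (1 : ℤ) ≤ |z i| := Int.one_le_abs hi
  simp only [latticePoint, Real.norm_eq_abs]
  exact_mod_cast this

/-- Nonzero lattice vectors have norm at least `1`, so no other representative of `b` can be closer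
to `a`. -/
theorem dist_torusProj_of_dist_le {a b : EuclideanSpace ℝ (Fin d)} (h : dist a b ≤ 1 / 2) :
    dist (torusProj d a) (torusProj d b) = dist a b := by
  refine le_antisymm (le_of_forall_gt fun r hr => ?_) (not_lt.1 fun hlt => ?_)
  · refine dist_torusProj_lt_iff.2 ⟨0, ?_⟩
    have : latticePoint (0 : Fin d → ℤ) = 0 := by ext i; simp [latticePoint]
    rwa [this, add_zero]
  · obtain ⟨z, hz⟩ := dist_torusProj_lt_iff.1 hlt
    rcases eq_or_ne z 0 with rfl | hz0
    · have : latticePoint (0 : Fin d → ℤ) = 0 := by ext i; simp [latticePoint]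
      rw [this, add_zero] at hz
      exact lt_irrefl _ hz
    · have h1 := one_le_norm_latticePoint hz0
      have h2 : ‖latticePoint z‖ ≤ dist a b + dist a (b + latticePoint z) := by
        have : latticePoint z = (a - b) - (a - (b + latticePoint z)) := by abel
        rw [dist_eq_norm, dist_eq_norm]
        nth_rewrite 1 [this]
        exact norm_sub_le _ _
      linarith

theorem disjoint_ball_latticePoint {b : EuclideanSpace ℝ (Fin d)} {r : ℝ} (hr : r ≤ 1 / 2)
    {z w : Fin d → ℤ} (hzw : z ≠ w) :
    Disjoint (Metric.ball (b + latticePoint z) r) (Metric.ball (b + latticePoint w) r) := by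
  refine Metric.ball_disjoint_ball ?_
  have h1 := one_le_norm_latticePoint (sub_ne_zero.2 hzw)
  rw [latticePoint_sub] at h1
  rw [dist_add_left, dist_eq_norm]
  linarith

/-- A connected set whose projection lies in a small ball lies in a single lift of the ball. -/
theorem subset_ball_of_torusProj_image_subset {U : Set (EuclideanSpace ℝ (Fin d))}
    (hU : IsPreconnected U) {b c : EuclideanSpace ℝ (Fin d)} {r : ℝ} (hr : r ≤ 1 / 2)
    (h : torusProj d '' U ⊆ Metric.ball (torusProj d b) r) (hc : c ∈ U)
    (hcb : c ∈ Metric.ball b r) : U ⊆ Metric.ball b r := by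
  have h0 : latticePoint (0 : Fin d → ℤ) = 0 := by ext i; simp [latticePoint]
  have hb : b + latticePoint (0 : Fin d → ℤ) = b := by rw [h0, add_zero]
  refine IsPreconnected.subset_left_of_subset_union Metric.isOpen_ball
    (v := ⋃ z : {z : Fin d → ℤ // z ≠ 0}, Metric.ball (b + latticePoint z.1) r)
    (isOpen_iUnion fun z => Metric.isOpen_ball) ?_ ?_ ⟨c, hc, hcb⟩ hU
  · refine disjoint_iUnion_right.2 fun z => ?_
    have := disjoint_ball_latticePoint (b := b) hr z.2.symm
    rwa [hb] at this
  · intro u hu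
    obtain ⟨z, hz⟩ := torusProj_mem_ball_iff.1 (h (mem_image_of_mem _ hu))
    rcases eq_or_ne z 0 with rfl | hz0
    · rw [hb] at hz
      exact Or.inl hz
    · exact Or.inr (mem_iUnion.2 ⟨⟨z, hz0⟩, hz⟩)

/-- The fundamental domain `[0, 1)^d`. -/
def halfOpenUnitCube (d : ℕ) : Set (EuclideanSpace ℝ (Fin d)) :=
  {x | ∀ i, x i ∈ Set.Ico (0 : ℝ) 1}

theorem halfOpenUnitCube_eq : halfOpenUnitCube d = dyadicCube 0 0 := by
  ext x; simp [halfOpenUnitCube, dyadicCube]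

theorem exists_sub_latticePoint_mem (x : EuclideanSpace ℝ (Fin d)) :
    ∃ z, x - latticePoint z ∈ halfOpenUnitCube d := by
  refine ⟨fun i => ⌊x i⌋, fun i => ?_⟩
  simp only [latticePoint, PiLp.sub_apply, mem_Ico]
  exact ⟨by linarith [Int.floor_le (x i)], by linarith [Int.lt_floor_add_one (x i)]⟩

instance isFiniteMeasure_torusMeasure : IsFiniteMeasure (torusMeasure d) := by
  have h : IsFiniteMeasure ((volume : Measure (EuclideanSpace ℝ (Fin d))).restrict
      (halfOpenUnitCube d)) := by
    rw [isFiniteMeasure_restrict, halfOpenUnitCube_eq, volume_dyadicCube]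
    exact ENNReal.ofReal_ne_top
  exact @Measure.isFiniteMeasure_map _ _ _ _ _ h _

theorem volume_inter_le_torusMeasure (s : Set (Torus d)) :
    volume (torusProj d ⁻¹' s ∩ halfOpenUnitCube d) ≤ torusMeasure d s := by
  have hm : MeasurableSet (halfOpenUnitCube d) := by
    rw [halfOpenUnitCube_eq]
    exact measurableSet_dyadicCube _ _
  rw [← Measure.restrict_apply' hm]
  exact Measure.le_map_apply continuous_torusProj.measurable.aemeasurable s

theorem ae_torusProj_mem {s : Set (Torus d)} (h : torusMeasure d sᶜ = 0) :
    ∀ᵐ x : EuclideanSpace ℝ (Fin d), torusProj d x ∈ s := by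
  have h0 : volume (torusProj d ⁻¹' sᶜ ∩ halfOpenUnitCube d) = 0 :=
    le_antisymm ((volume_inter_le_torusMeasure _).trans h.le) zero_le
  have hsub : torusProj d ⁻¹' sᶜ ⊆ ⋃ z, (fun x => x + latticePoint (-z)) ⁻¹'
      (torusProj d ⁻¹' sᶜ ∩ halfOpenUnitCube d) := by
    intro x hx
    obtain ⟨z, hz⟩ := exists_sub_latticePoint_mem x
    refine mem_iUnion.2 ⟨z, ?_, ?_⟩
    · rw [mem_preimage, torusProj_add_latticePoint]
      exact hx
    · simpa only [mem_preimage, latticePoint_neg, ← sub_eq_add_neg] using hz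
  refine measure_mono_null hsub (measure_iUnion_null fun z => ?_)
  rw [measure_preimage_add_right, h0]

/-- Lattice translates of the fundamental domain cut the ball into pieces. Moved back into the
domain, the pieces are disjoint because the lifts of a ball of radius at most `1 / 2` are. -/
theorem volume_ball_le_torusMeasure (b : EuclideanSpace ℝ (Fin d)) {r : ℝ} (hr : r ≤ 1 / 2) :
    volume (Metric.ball b r) ≤ torusMeasure d (Metric.ball (torusProj d b) r) := by
  have hm : MeasurableSet (halfOpenUnitCube d) := by
    rw [halfOpenUnitCube_eq]
    exact measurableSet_dyadicCube _ _
  have hsub : Metric.ball b r ⊆ ⋃ z, (fun x => x + latticePoint (-z)) ⁻¹'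
      (Metric.ball (b + latticePoint (-z)) r ∩ halfOpenUnitCube d) := by
    intro x hx
    obtain ⟨z, hz⟩ := exists_sub_latticePoint_mem x
    refine mem_iUnion.2 ⟨z, ?_, ?_⟩
    · rwa [Metric.mem_ball, dist_add_right]
    · simpa only [mem_preimage, latticePoint_neg, ← sub_eq_add_neg] using hz
  calc _ ≤ ∑' z : Fin d → ℤ, volume ((fun x => x + latticePoint (-z)) ⁻¹'
        (Metric.ball (b + latticePoint (-z)) r ∩ halfOpenUnitCube d)) :=
        (measure_mono hsub).trans (measure_iUnion_le _)
    _ = ∑' z : Fin d → ℤ, volume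
        (Metric.ball (b + latticePoint (-z)) r ∩ halfOpenUnitCube d) :=
        tsum_congr fun z => measure_preimage_add_right _ _ _
    _ = volume (⋃ z : Fin d → ℤ, Metric.ball (b + latticePoint (-z)) r ∩ halfOpenUnitCube d) := by
        refine (measure_iUnion (fun z w hzw => ?_)
          fun z => Metric.isOpen_ball.measurableSet.inter hm).symm
        exact (disjoint_ball_latticePoint hr (neg_injective.ne hzw)).mono inter_subset_left
          inter_subset_left
    _ ≤ volume (torusProj d ⁻¹' (Metric.ball (torusProj d b) r) ∩ halfOpenUnitCube d) :=
        measure_mono (iUnion_subset fun z x hx => ⟨torusProj_mem_ball_iff.2 ⟨-z, hx.1⟩, hx.2⟩)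
    _ ≤ _ := volume_inter_le_torusMeasure _

end TorusGeometry

/-! ### Hausdorff dimension -/

section Dimension

variable {d : ℕ}

/-- A set of positive diameter `a` is covered by `3^d` cubes of side less than `2 * a`. For diameter
zero the cubes shrink to a point, and `t > 0` sends their weight to zero. -/
theorem dyadicContent_le_ediam_rpow (hd : 1 ≤ d) {t : ℝ} (ht : 0 < t)
    {A : Set (EuclideanSpace ℝ (Fin d))} (hA : Metric.ediam A ≤ 1) :
    dyadicContent t A ≤ 3 ^ d * ENNReal.ofReal (2 * unitDiam d) ^ t * Metric.ediam A ^ t := by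
  have hΔ := unitDiam_pos hd
  have hfin : Metric.ediam A ≠ ⊤ := (hA.trans_lt ENNReal.one_lt_top).ne
  have hdist : ∀ x ∈ A, ∀ y ∈ A, dist x y ≤ (Metric.ediam A).toReal := fun x hx y hy => by
    rw [dist_edist]
    exact ENNReal.toReal_mono hfin (Metric.edist_le_ediam_of_mem hx hy)
  rcases eq_or_ne (Metric.ediam A) 0 with h0 | h0
  · have hlim : Tendsto (fun n : ℕ => (3 ^ d : ENNReal) *
        ENNReal.ofReal (genDiam d n) ^ t) atTop
        (𝓝 (3 ^ d * ENNReal.ofReal (0 * unitDiam d) ^ t)) := by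
      refine ENNReal.Tendsto.const_mul ?_ (Or.inr (by simp))
      refine (ENNReal.continuous_rpow_const.tendsto _).comp
        (ENNReal.tendsto_ofReal (Tendsto.mul_const _ ?_))
      simpa using tendsto_pow_atTop_nhds_zero_of_lt_one (r := (2 : ℝ)⁻¹) (by norm_num)
        (by norm_num)
    have h1 : dyadicContent t A ≤ 3 ^ d * ENNReal.ofReal (0 * unitDiam d) ^ t :=
      ge_of_tendsto' hlim fun n => dyadicContent_le_of_dist_le fun x hx y hy =>
        (hdist x hx y hy).trans (by rw [h0, ENNReal.toReal_zero]; positivity)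
    refine h1.trans ?_
    simp [ENNReal.zero_rpow_of_pos ht]
  · set a := (Metric.ediam A).toReal with ha_def
    have ha : 0 < a := ENNReal.toReal_pos h0 hfin
    obtain ⟨n, hn1, hn2⟩ := exists_mem_Ioc_zpow ha (one_lt_two (α := ℝ))
    have h1 := dyadicContent_le_of_dist_le (t := t) (A := A) (n := -(n + 1)) fun x hx y hy =>
      (hdist x hx y hy).trans (by rwa [neg_neg])
    refine h1.trans ?_
    rw [mul_assoc, ← ENNReal.mul_rpow_of_nonneg _ _ ht.le]
    gcongr
    rw [← ENNReal.ofReal_toReal hfin, ← ha_def, ← ENNReal.ofReal_mul (by positivity)]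
    refine ENNReal.ofReal_le_ofReal ?_
    rw [genDiam, neg_neg, zpow_add₀ (by norm_num), zpow_one]
    nlinarith

/-- The dyadic content as an outer measure. -/
noncomputable def dyadicContentOuterMeasure (d : ℕ) (t : ℝ) :
    OuterMeasure (EuclideanSpace ℝ (Fin d)) where
  measureOf := dyadicContent t
  empty := le_antisymm ((dyadicContent_le (S := ∅) (empty_subset _)).trans
    (by simp [coverSum])) zero_le
  mono := dyadicContent_mono
  iUnion_nat s _ := dyadicContent_iUnion_le t s

/-- Up to a constant, the content is an outer measure bounded by `r ^ t` on sets of diameter `r ≤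
1`. The Hausdorff measure, built from the largest such outer measures, therefore dominates it. -/
theorem ofReal_le_dimH_of_dyadicContent_ne_zero (hd : 1 ≤ d) {t : ℝ} (ht : 0 < t)
    {A : Set (EuclideanSpace ℝ (Fin d))} (hA : dyadicContent t A ≠ 0) :
    ENNReal.ofReal t ≤ dimH A := by
  refine le_dimH_of_hausdorffMeasure_ne_zero (d := t.toNNReal) fun h => hA ?_
  rw [Real.coe_toNNReal t ht.le] at h
  set K : ENNReal := 3 ^ d * ENNReal.ofReal (2 * unitDiam d) ^ t
  have hΔ := unitDiam_pos hd
  have hK0 : K ≠ 0 := mul_ne_zero (by positivity) (ENNReal.rpow_pos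
    (ENNReal.ofReal_pos.2 (by positivity)) ENNReal.ofReal_ne_top).ne'
  have hKt : K ≠ ⊤ := ENNReal.mul_ne_top (by simp)
    (ENNReal.rpow_ne_top_of_nonneg ht.le ENNReal.ofReal_ne_top)
  have hle : K⁻¹ • dyadicContentOuterMeasure d t ≤ OuterMeasure.mkMetric fun r => r ^ t := by
    refine OuterMeasure.le_mkMetric _ _ 1 one_pos fun s hs => ?_
    rw [smul_apply, smul_eq_mul, ← ENNReal.div_eq_inv_mul]
    exact ENNReal.div_le_of_le_mul' (dyadicContent_le_ediam_rpow hd ht hs)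
  have h1 := hle A
  rw [← Measure.mkMetric_toOuterMeasure] at h1
  have h2 : K⁻¹ * dyadicContent t A = 0 := le_antisymm (h1.trans h.le) zero_le
  exact (mul_eq_zero.1 h2).resolve_left (ENNReal.inv_ne_zero.2 hKt)

theorem dimH_torusProj_image {F : Set (EuclideanSpace ℝ (Fin d))}
    (hF : ∀ x ∈ F, ∀ y ∈ F, dist x y ≤ 1 / 2) : dimH (torusProj d '' F) = dimH F := by
  have hiso : Isometry fun x : F => torusProj d x :=
    Isometry.of_dist_eq fun x y => dist_torusProj_of_dist_le (hF x x.2 y y.2)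
  have h1 : dimH F = dimH (univ : Set F) := by
    rw [← isometry_subtype_coe.dimH_image univ, image_univ, Subtype.range_coe]
  have h2 : torusProj d '' F = (fun x : F => torusProj d x) '' univ := by
    rw [image_univ, image_eq_range]
  rw [h1, h2, hiso.dimH_image]

/-- One dyadic cube of diameter less than `1 / 2` is enough, since `π` is isometric on it. -/
theorem ofReal_le_dimH_of_preimage_content (hd : 1 ≤ d) {t : ℝ} (ht : 0 < t) {L : Set (Torus d)}
    (hL : ∀ n k, Metric.ediam (dyadicCube n k) ^ t ≤
      dyadicContent t (torusProj d ⁻¹' L ∩ dyadicCube n k)) :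
    ENNReal.ofReal t ≤ dimH L := by
  have hlim : Tendsto (fun n : ℕ => genDiam d n) atTop (𝓝 (0 * unitDiam d)) := by
    refine Tendsto.mul_const _ ?_
    simpa using tendsto_pow_atTop_nhds_zero_of_lt_one (r := (2 : ℝ)⁻¹) (by norm_num) (by norm_num)
  rw [zero_mul] at hlim
  obtain ⟨n, hn⟩ := (hlim.eventually (gt_mem_nhds (show (0 : ℝ) < 1 / 2 by norm_num))).exists
  have h1 : dyadicContent t (torusProj d ⁻¹' L ∩ dyadicCube (n : ℤ) 0) ≠ 0 := by
    refine (lt_of_lt_of_le ?_ (hL n 0)).ne'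
    rw [ediam_dyadicCube_eq_ofReal]
    exact ENNReal.rpow_pos (ENNReal.ofReal_pos.2 (genDiam_pos hd n)) ENNReal.ofReal_ne_top
  refine (ofReal_le_dimH_of_dyadicContent_ne_zero hd ht h1).trans ?_
  rw [← dimH_torusProj_image fun x hx y hy => (dist_le_genDiam hx.2 hy.2).trans hn.le]
  exact dimH_mono (image_subset_iff.2 inter_subset_left)

end Dimension

/-! ### Limsup sets on the torus -/

section LimsupSets

variable {d : ℕ}

theorem mem_limsup_atTop_iff {α : Type*} {s : ℕ → Set α} {x : α} :
    x ∈ limsup s atTop ↔ ∀ m, ∃ j ≥ m, x ∈ s j := by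
  rw [mem_limsup_iff_frequently_mem, frequently_atTop]

theorem isGδ_preimage_limsup {s : ℕ → Set (Torus d)} (hs : ∀ j, IsOpen (s j)) :
    IsGδ (torusProj d ⁻¹' limsup s atTop) := by
  have : torusProj d ⁻¹' limsup s atTop = ⋂ m : ℕ, ⋃ j : {j // j ≥ m}, torusProj d ⁻¹' s j := by
    ext x
    rw [mem_preimage, mem_limsup_atTop_iff]
    simp
  rw [this]
  exact IsGδ.iInter_of_isOpen fun m => isOpen_iUnion fun j => (hs j).preimage continuous_torusProj

/-- The content of limsup sets of images of ellipsoids or rectangles `U j`. -/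
theorem ediam_rpow_le_dyadicContent_limsup (hd : 1 ≤ d) {x : ℕ → Torus d} {r : ℕ → ℝ}
    (hr : Tendsto r atTop (𝓝 0))
    (hE : torusMeasure d (limsup (fun j => Metric.ball (x j) (r j)) atTop)ᶜ = 0)
    (A : ℕ → PrincipalAxes d) {U : ℕ → Set (EuclideanSpace ℝ (Fin d))}
    (hUo : ∀ j, IsOpen (U j)) (hUs : ∀ j, StarConvex ℝ (A j).center (U j))
    (hcore : ∀ j, (A j).core ⊆ U j) (hrect : ∀ j, U j ⊆ (A j).rectangle)
    (hUB : ∀ j, torusProj d '' U j ⊆ Metric.ball (x j) (r j)) {t t' C : ℝ} (ht : 0 < t)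
    (htt' : t < t') (htd : t' ≤ d) (hC : 0 ≤ C)
    (hbdd : ∀ j, (torusMeasure d (Metric.ball (x j) (r j))).toReal ≤ C * (A j).singularValue t')
    (n : ℤ) (k : Fin d → ℤ) :
    Metric.ediam (dyadicCube n k) ^ t ≤ dyadicContent t
      (torusProj d ⁻¹' limsup (fun j => torusProj d '' U j) atTop ∩ dyadicCube n k) := by
  have ht' : 0 < t' := ht.trans htt'
  have hcU : ∀ j, (A j).center ∈ U j := fun j => hcore j ((A j).center_mem_core hd)
  -- Among the lifts of `x j`, the one whose ball contains the centre of `A j` is chosen; by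
  -- connectedness that ball then contains all of `U j` once `r j < 1 / 2`.
  have hlift : ∀ j, ∃ y, torusProj d y = x j ∧ (A j).center ∈ Metric.ball y (r j) := by
    intro j
    obtain ⟨b, hb⟩ := torusProj_surjective (x j)
    have h1 := hUB j (mem_image_of_mem _ (hcU j))
    rw [← hb] at h1
    obtain ⟨z, hz⟩ := torusProj_mem_ball_iff.1 h1
    exact ⟨b + latticePoint z, by rw [torusProj_add_latticePoint, hb], hz⟩
  choose y hy hyc using hlift
  have hrpos : ∀ j, 0 < r j := fun j => Metric.pos_of_mem_ball (hyc j)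
  obtain ⟨j₀, hj₀⟩ := eventually_atTop.1 (hr.eventually (gt_mem_nhds (show (0 : ℝ) < 1 / 2 by
    norm_num)))
  have hUball : ∀ j ≥ j₀, U j ⊆ Metric.ball (y j) (r j) := fun j hj =>
    subset_ball_of_torusProj_image_subset
      ((hUs j).isPathConnected (hcU j)).isConnected.isPreconnected (hj₀ j hj).le
      (by rw [hy]; exact hUB j) (hcU j) (hyc j)
  -- All lattice translates are included, so the corresponding balls form a fine cover of almost all
  -- of `ℝ^d`. The offset `j₀` keeps the radii below `1 / 2`.
  let G : ℕ → Set (EuclideanSpace ℝ (Fin d)) := fun m =>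
    ⋃ a : {j // j ≥ m + j₀} × (Fin d → ℤ), (fun u => u + -latticePoint a.2) ⁻¹' U a.1
  have hG : ∀ m, HasDyadicFillings t 1 (G m) := by
    intro m
    suffices h : ∃ c, c ≠ 0 ∧ HasDyadicFillings t c (G m) by
      obtain ⟨c, hc, hfill⟩ := h
      exact hfill.one ht.le (htt'.trans_le htd) hc
    refine hasDyadicFillings_iUnion hd
      (ι := {j // j ≥ m + j₀} × (Fin d → ℤ))
      (y := fun a => y a.1 + latticePoint a.2) (r := fun a => r a.1)
      (V := fun a => (fun u => u + -latticePoint a.2) ⁻¹' U a.1)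
      (t := t) (t' := t') (C := C * (2 * d) ^ d) ht.le htt' (htt'.le.trans htd) (by positivity)
      (fun a => hrpos a.1) (fun a => (hUo a.1).preimage (by fun_prop))
      (fun a => ⟨(A a.1).center + latticePoint a.2, by
        rw [mem_preimage, add_neg_cancel_right]; exact hcU a.1⟩)
      (fun a u hu => by
        have h1 := hUball a.1 (by have := a.1.2; omega) hu
        rw [Metric.mem_ball] at h1 ⊢
        rwa [← dist_add_right _ _ (latticePoint a.2), neg_add_cancel_right] at h1) ?_ ?_
    · rintro ⟨⟨j, hj⟩, z⟩ l q
      have hQ : volume ((fun u => u + -latticePoint z) ⁻¹' U j ∩ dyadicCube l q) =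
          volume (U j ∩ (fun u => u + latticePoint z) ⁻¹' dyadicCube l q) := by
        rw [← measure_preimage_add_right volume (-latticePoint z)
          (U j ∩ (fun u => u + latticePoint z) ⁻¹' dyadicCube l q), preimage_inter]
        congr 2
        ext u
        simp
      have hball : volume (Metric.ball (y j + latticePoint z) (r j)) ≤
          ENNReal.ofReal C * ENNReal.ofReal ((A j).singularValue t') := by
        have h1 := volume_ball_le_torusMeasure (y j + latticePoint z)
          (hj₀ j (by omega)).le
        rw [torusProj_add_latticePoint, hy] at h1
        refine h1.trans ?_
        rw [← ENNReal.ofReal_mul hC, ← ENNReal.ofReal_toReal (measure_ne_top (torusMeasure d)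
          (Metric.ball (x j) (r j)))]
        exact ENNReal.ofReal_le_ofReal (hbdd j)
      simp only
      rw [hQ, measure_preimage_add_right]
      calc _ ≤ ENNReal.ofReal C * ENNReal.ofReal ((A j).singularValue t') *
            volume (U j ∩ (fun u => u + latticePoint z) ⁻¹' dyadicCube l q) := by gcongr
        _ ≤ ENNReal.ofReal C * (ENNReal.ofReal ((2 * d) ^ d * genDiam d l ^ t') *
              volume (U j)) := by
            rw [mul_assoc]
            refine mul_le_mul_right ((A j).singularValue_mul_volume_inter_le hd (hcore j) (hrect j)
              ht' htd (genDiam_pos hd l) fun u hu v hv => ?_) _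
            rw [← dist_add_right _ _ (latticePoint z)]
            exact dist_le_genDiam hu hv
        _ = _ := by rw [← mul_assoc, ← ENNReal.ofReal_mul hC, mul_assoc]
    · filter_upwards [ae_torusProj_mem hE] with u hu ε hε
      obtain ⟨j₁, hj₁⟩ := eventually_atTop.1 (hr.eventually (gt_mem_nhds hε))
      obtain ⟨j, hj, huj⟩ := mem_limsup_atTop_iff.1 hu (max j₁ (m + j₀))
      rw [← hy] at huj
      obtain ⟨z, hz⟩ := torusProj_mem_ball_iff.1 huj
      exact ⟨(⟨j, (le_max_right _ _).trans hj⟩, z), hj₁ j ((le_max_left _ _).trans hj), hz⟩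
  refine (ediam_rpow_le_dyadicContent_iInter ht.le (htt'.trans_le htd) hG n k).trans
    (dyadicContent_mono (inter_subset_inter_left _ fun u hu => ?_))
  refine mem_limsup_atTop_iff.2 fun m => ?_
  obtain ⟨⟨⟨j, hj⟩, z⟩, hz⟩ := mem_iUnion.1 (mem_iInter.1 hu m)
  refine ⟨j, by omega, _, hz, ?_⟩
  rw [← latticePoint_neg, torusProj_add_latticePoint]

theorem limsup_mem_torusLargeIntersectionClass (hd : 1 ≤ d) {x : ℕ → Torus d} {r : ℕ → ℝ}
    (hr : Tendsto r atTop (𝓝 0))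
    (hE : torusMeasure d (limsup (fun j => Metric.ball (x j) (r j)) atTop)ᶜ = 0)
    (A : ℕ → PrincipalAxes d) {s : ℝ}
    (hs : s = sSup {t : ℝ | 0 ≤ t ∧ t ≤ d ∧
      BddAbove (Set.range fun j =>
        (torusMeasure d (Metric.ball (x j) (r j))).toReal / (A j).singularValue t)})
    {U : ℕ → Set (EuclideanSpace ℝ (Fin d))}
    (hUo : ∀ j, IsOpen (U j)) (hUs : ∀ j, StarConvex ℝ (A j).center (U j))
    (hcore : ∀ j, (A j).core ⊆ U j) (hrect : ∀ j, U j ⊆ (A j).rectangle)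
    (hUB : ∀ j, torusProj d '' U j ⊆ Metric.ball (x j) (r j)) :
    ENNReal.ofReal s ≤ dimH (limsup (fun j => torusProj d '' U j) atTop) ∧
      limsup (fun j => torusProj d '' U j) atTop ∈ torusLargeIntersectionClass d s := by
  have hcontent : ∀ t, 0 < t → t < s → ∀ n k, Metric.ediam (dyadicCube n k) ^ t ≤
      dyadicContent t
        (torusProj d ⁻¹' limsup (fun j => torusProj d '' U j) atTop ∩ dyadicCube n k) := by
    intro t ht hts
    have hne : {t : ℝ | 0 ≤ t ∧ t ≤ d ∧ BddAbove (Set.range fun j =>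
        (torusMeasure d (Metric.ball (x j) (r j))).toReal / (A j).singularValue t)}.Nonempty := by
      -- If no exponent were admissible, `sSup ∅ = 0` would give `s = 0`, contradicting `0 < t < s`.
      by_contra hcon
      rw [not_nonempty_iff_eq_empty.1 hcon, Real.sSup_empty] at hs
      linarith
    obtain ⟨t', ⟨h0, htd, C, hC⟩, htt'⟩ := exists_lt_of_lt_csSup hne (hs ▸ hts)
    have hC' : ∀ j, (torusMeasure d (Metric.ball (x j) (r j))).toReal / (A j).singularValue t' ≤ C :=
      fun j => hC (mem_range_self j)
    refine ediam_rpow_le_dyadicContent_limsup hd hr hE A hUo hUs hcore hrect hUB ht htt' htd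
      (C := C) ((div_nonneg ENNReal.toReal_nonneg ((A 0).singularValue_pos t').le).trans (hC' 0))
      fun j => (div_le_iff₀ ((A j).singularValue_pos t')).1 (hC' j)
  refine ⟨not_lt.1 fun hlt => ?_, isGδ_preimage_limsup fun j => isOpenMap_torusProj _ (hUo j),
    fun n k t ht hts => hcontent t ht hts n k⟩
  obtain ⟨t, h0, h1, h2⟩ := ENNReal.lt_iff_exists_real_btwn.1 hlt
  have ht : 0 < t := ENNReal.ofReal_pos.1 (zero_le.trans_lt h1)
  exact absurd (ofReal_le_dimH_of_preimage_content hd ht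
    (hcontent t ht (ENNReal.ofReal_lt_ofReal_iff_of_nonneg h0 |>.1 h2))) (not_le.2 h1)

end LimsupSets

theorem mainTheorem5 (d : ℕ) (hd : 1 ≤ d)
    (x : ℕ → Torus d) (r : ℕ → ℝ) (hr : Tendsto r atTop (𝓝 0))
    (hE : torusMeasure d (limsup (fun j => Metric.ball (x j) (r j)) atTop)ᶜ = 0)
    (A : ℕ → PrincipalAxes d) (s : ℝ)
    (hs : s = sSup {t : ℝ | 0 ≤ t ∧ t ≤ d ∧
      BddAbove (Set.range fun j =>
        (torusMeasure d (Metric.ball (x j) (r j))).toReal / (A j).singularValue t)}) :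
    ((∀ j, torusProj d '' (A j).ellipsoid ⊆ Metric.ball (x j) (r j)) →
      ENNReal.ofReal s ≤ dimH (limsup (fun j => torusProj d '' (A j).ellipsoid) atTop) ∧
      limsup (fun j => torusProj d '' (A j).ellipsoid) atTop
        ∈ torusLargeIntersectionClass d s) ∧
    ((∀ j, torusProj d '' (A j).rectangle ⊆ Metric.ball (x j) (r j)) →
      ENNReal.ofReal s ≤ dimH (limsup (fun j => torusProj d '' (A j).rectangle) atTop) ∧
      limsup (fun j => torusProj d '' (A j).rectangle) atTop
        ∈ torusLargeIntersectionClass d s) := by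
  refine ⟨fun hU => ?_, fun hU => ?_⟩
  · exact limsup_mem_torusLargeIntersectionClass hd hr hE A hs (fun j => (A j).isOpen_ellipsoid)
      (fun j => (A j).starConvex_ellipsoid) (fun j => (A j).core_subset_ellipsoid hd)
      (fun j => (A j).ellipsoid_subset_rectangle) hU
  · exact limsup_mem_torusLargeIntersectionClass hd hr hE A hs (fun j => (A j).isOpen_rectangle)
      (fun j => (A j).starConvex_rectangle) (fun j => (A j).core_subset_rectangle hd)
      (fun j => Subset.rfl) hU
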